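/- Let $U$ be any universal prefix-free machine, i.e. a partial computable function $U$ from binary strings to natural numbers (binary strings being coded as natural numbers in a fixed effective way) whose domain contains no string together with a proper extension of it, and such that for every prefix-free machine $M$ there is a constant $d$ with $K(x)\le K_M(x)+d$ for all $x$; here $K_M(x)$ is the length of a shortest $\sigma$ with $M(\sigma)=x$ ($\infty$ if there is none), and $K=K_U$. Fix a program for $U$ and let $K_s(x)$ be the length of a shortest $\sigma$ on which this program outputs $x$ within $s$ steps, with $K_s(x)=\infty$ if there is none or if $x\ge s$; put $2^{-\infty}=0$, and $$c_K(x,s)=\sum_{x<w\le s}2^{-K_s(w)},\qquad c_{\max}(x,s)=\max\{2^{-K_s(w)}: x<w\le s\}\quad(\max\emptyset=0).$$ A computable approximation of $A\subseteq\mathbb N$ is a computable sequence $(A_s)_{s\in\mathbb N}$ of finite sets (given by explicit lists) with $\lim_s A_s(x)=A(x)$ for each $x$. It is erasing if for all $x$ and all $s>0$, $A_s(x)\ne A_{s-1}(x)$ implies $A_s(y)=0$ whenever $x<y\le s$. It obeys a cost function $c$ if $\sum_{s>0}c(x_s,s)<\infty$, where $x_s$ is the least $x<s$ with $A_s(x)\ne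 A_{s-1}(x)$, and the summand is $0$ if there is no such $x$. The set $A$ obeys $c$ if some computable approximation of $A$ obeys $c$. For a binary string $\alpha$ let $g(\alpha)$ be the longest prefix of $\alpha$ ending in $1$ (the empty string if there is none), and let $A\upharpoonright n=A(0)\dots A(n-1)$. Then there is a set $A\subseteq\mathbb N$ such that 1. $A$ has an erasing computable approximation that obeys $c_{\max}$, but $A$ does not obey $c_K$; 2. $A$ is weakly $K$-trivial: there is a constant $b$ with $K(g(A\upharpoonright n))\le K(n)+b$ for all $n$; 3. $A$ is not $K$-trivial: there is no constant $b$ with $K(A\upharpoonright n)\le K(n)+b$ for all $n$. -/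

import Mathlib

open Nat.Partrec (Code)

namespace CostCalculus

/-! Machines are given by codes of partial recursive functions. A binary string `σ : List Bool` is
passed to the machine through its standard numerical code; outputs are natural numbers, and an
output `y` stands for the string `α` when `y = Encodable.encode α`. -/

/-- The machine coded by `M` halts on input `σ` with output `y`. -/
def Outputs (M : Code) (σ : List Bool) (y : ℕ) : Prop :=
  y ∈ M.eval (Encodable.encode σ)

/-- The machine coded by `M` halts on input `σ` with output `y` within `s` steps. -/
def OutputsBy (M : Code) (s : ℕ) (σ : List Bool) (y : ℕ) : Prop :=
  y ∈ M.evaln s (Encodable.encode σ)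

/-- `M` is a prefix-free machine: no string in its domain properly extends another one. -/
def IsPrefixFree (M : Code) : Prop :=
  ∀ (σ τ : List Bool) (y z : ℕ), Outputs M σ y → Outputs M τ z → σ <+: τ → σ = τ

/-- Complexity of the number `x` with respect to the machine `M` (`⊤` without description). -/
noncomputable def K (M : Code) (x : ℕ) : ℕ∞ :=
  ⨅ (σ : List Bool) (_ : Outputs M σ x), (σ.length : ℕ∞)

/-- Complexity of the string `α` with respect to the machine `M`. -/
noncomputable def KStr (M : Code) (α : List Bool) : ℕ∞ :=
  K M (Encodable.encode α)

/-- `U` is a universal (optimal) prefix-free machine: it is prefix-free, and it describes as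
shortly as any other prefix-free machine, up to an additive constant. -/
def IsUniversal (U : Code) : Prop :=
  IsPrefixFree U ∧
    ∀ M : Code, IsPrefixFree M → ∃ d : ℕ, ∀ x : ℕ, K U x ≤ K M x + d

open Classical in
/-- Complexity of `x` at stage `s`, with the convention that it is `∞` for `x ≥ s`. -/
noncomputable def KStage (U : Code) (s x : ℕ) : ℕ∞ :=
  if x < s then ⨅ (σ : List Bool) (_ : OutputsBy U s σ x), (σ.length : ℕ∞) else ⊤

/-- `2 ^ (-k)`, where `2 ^ (-∞) = 0`. -/
def twoPowNeg : ℕ∞ → ℚ≥0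
  | none => 0
  | some k => (1 / 2) ^ k

/-- The standard cost function: the sum of `2 ^ (-K_s(w))` over `x < w ≤ s`. -/
noncomputable def cK (U : Code) (x s : ℕ) : ℚ≥0 :=
  ∑ w ∈ Finset.Ioc x s, twoPowNeg (KStage U s w)

/-- The maximum of `2 ^ (-K_s(w))` over `x < w ≤ s` (and `0` if there is no such `w`). -/
noncomputable def cMax (U : Code) (x s : ℕ) : ℚ≥0 :=
  (Finset.Ioc x s).sup fun w => twoPowNeg (KStage U s w)

/-- `As` is a computable sequence of (explicitly given) finite sets that converges pointwise
to `A`. -/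
def IsComputableApprox (As : ℕ → Finset ℕ) (A : Set ℕ) : Prop :=
  (∃ l : ℕ → List ℕ, Computable l ∧ ∀ s, (l s).toFinset = As s) ∧
    ∀ x, ∃ t, ∀ s ≥ t, (x ∈ As s ↔ x ∈ A)

/-- Whenever membership of `x` changes at a stage `s > 0`, all `y` with `x < y ≤ s` are out of the
set at stage `s`. -/
def IsErasing (As : ℕ → Finset ℕ) : Prop :=
  ∀ x s, 0 < s → ¬(x ∈ As s ↔ x ∈ As (s - 1)) → ∀ y, x < y → y ≤ s → y ∉ As s

open Classical in
/-- The cost of the changes at stage `s > 0`: it is `c x s` for the least `x < s` whose membership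
changes, and `0` if there is no such `x` (in particular for `s = 0`). -/
noncomputable def changeCost (c : ℕ → ℕ → ℚ≥0) (As : ℕ → Finset ℕ) (s : ℕ) : ℚ≥0 :=
  if h : ∃ x, x < s ∧ ¬(x ∈ As (s - 1) ↔ x ∈ As s) then c (Nat.find h) s else 0

/-- The sequence `As` obeys `c`: the total cost of all changes is finite. -/
def SeqObeys (As : ℕ → Finset ℕ) (c : ℕ → ℕ → ℚ≥0) : Prop :=
  Summable fun s : ℕ => (changeCost c As s : ℝ)

/-- The set `A` obeys `c`: some computable approximation of `A` obeys `c`. -/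
def SetObeys (A : Set ℕ) (c : ℕ → ℕ → ℚ≥0) : Prop :=
  ∃ As : ℕ → Finset ℕ, IsComputableApprox As A ∧ SeqObeys As c

open Classical in
/-- The initial segment `A(0) A(1) ... A(n-1)` of the characteristic sequence of `A`. -/
noncomputable def initSeg (A : Set ℕ) (n : ℕ) : List Bool :=
  (List.range n).map fun i => decide (i ∈ A)

/-- The longest prefix of `α` that ends in `1` (empty if there is none): all final zeros are
removed. -/
def g (α : List Bool) : List Bool :=
  α.rdropWhile fun b => !b

/-- `A` is `K`-trivial. -/
def IsKTrivial (U : Code) (A : Set ℕ) : Prop :=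
  ∃ b : ℕ, ∀ n : ℕ, KStr U (initSeg A n) ≤ K U n + b

/-- `A` is weakly `K`-trivial. -/
def IsWeaklyKTrivial (U : Code) (A : Set ℕ) : Prop :=
  ∃ b : ℕ, ∀ n : ℕ, KStr U (g (initSeg A n)) ≤ K U n + b

end CostCalculus

/-! The set moves only when descriptions that the move makes useless pay for it. At stage `s + 1`
the least qualifying `x` outside the current set enters, and all larger elements leave. To qualify,
the initial segments of lengths in `(x, s + 1]` must have descriptions of total weight at least
`cMax U x (s + 1)` and at least `2 ^ (-y)`, where `y = x.unpair.1`. Each move increases the set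
lexicographically, so an abandoned segment never returns, and by Kraft the weight abandoned over all
stages is at most one (`sum_actMass_le_one`). Hence the approximation converges, is erasing and
obeys `cMax`. After a move at `x` all segments longer than `x` have the same image under `g`, so a
single request, as short as the cheapest number above `x`, serves them all; this gives weak
`K`-triviality (`isWeaklyKTrivial_limitSet`).

Suppose the limit set were `K`-trivial. Among the positions `Nat.pair y i` with `i ≤ 2 ^ y` one
never acts (`exists_never_actPos`), so it fails to qualify at all late stages. Together with
`K`-triviality, this bounds the total weight of the numbers above `columnBound y` by a constant
times the largest single weight above `y` (`exists_sum_le_cMax`). To refute this, small weights are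
placed on fresh numbers, one per round. A round ends when, above each earlier stage of the sequence,
some single number weighs, up to a fixed factor, as much as everything placed since
(`exists_isRunStage`). Over `2 ^ p` rounds the heavy numbers found in dyadic blocks of rounds add up
to about `p / 2` times the single-scale total (`sum_min_ge_of_heavy`), which exceeds one for
suitable `p` (`not_isRunStage_last`).

A set obeying `cK` is `K`-trivial (`IsUniversal.isKTrivial_of_obeys`), so failure of `K`-triviality
also excludes obedience to `cK`. -/

namespace CostCalculus

open Encodable

/-! ### Weights -/

@[simp] theorem twoPowNeg_top : twoPowNeg ⊤ = 0 := rfl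

@[simp] theorem twoPowNeg_coe (k : ℕ) : twoPowNeg (k : ℕ∞) = (1 / 2) ^ k := rfl

theorem twoPowNeg_anti {a b : ℕ∞} (h : a ≤ b) : twoPowNeg b ≤ twoPowNeg a := by
  induction b using ENat.recTopCoe with
  | top => simp
  | coe b =>
    lift a to ℕ using ne_top_of_le_ne_top (ENat.natCast_ne_top b) h
    simp only [twoPowNeg_coe]
    exact pow_le_pow_of_le_one (by norm_num) (by norm_num) (by exact_mod_cast h)

theorem twoPowNeg_add (a : ℕ∞) (d : ℕ) : twoPowNeg (a + d) = twoPowNeg a * (1 / 2) ^ d := by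
  induction a using ENat.recTopCoe with
  | top => simp
  | coe a => rw [← Nat.cast_add, twoPowNeg_coe, twoPowNeg_coe, pow_add]

theorem cast_twoPowNeg_coe (k : ℕ) : (twoPowNeg (k : ℕ∞) : ℝ) = (1 / 2) ^ k := by
  rw [twoPowNeg_coe]; push_cast; rfl

theorem cast_twoPowNeg_anti {a b : ℕ∞} (h : a ≤ b) : (twoPowNeg b : ℝ) ≤ twoPowNeg a := by
  exact_mod_cast twoPowNeg_anti h

theorem cast_twoPowNeg_add (a : ℕ∞) (d : ℕ) :
    (twoPowNeg (a + d) : ℝ) = twoPowNeg a * (1 / 2) ^ d := by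
  rw [twoPowNeg_add]; push_cast; rfl

/-- The weight `2 ^ (-k)` of a request of length `k`, and `0` if nothing is requested. -/
noncomputable def requestWeight (o : Option ℕ) : ℝ := o.elim 0 fun k => (1 / 2) ^ k

@[simp] theorem requestWeight_none : requestWeight none = 0 := rfl

@[simp] theorem requestWeight_some (k : ℕ) : requestWeight (some k) = (1 / 2) ^ k := rfl

theorem requestWeight_nonneg (o : Option ℕ) : 0 ≤ requestWeight o := by
  cases o <;> simp

/-! ### The Kraft inequality -/

/-- The first code words of two factorizations of one string are comparable, hence equal, and
cancel. -/
theorem prefixFree_uniquelyDecodable {S : Set (List Bool)} (h0 : [] ∉ S)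
    (h : ∀ σ ∈ S, ∀ τ ∈ S, σ <+: τ → σ = τ) : InformationTheory.UniquelyDecodable S := by
  intro L₁
  induction L₁ with
  | nil =>
    intro L₂ _ h₂ he
    cases L₂ with
    | nil => rfl
    | cons a L =>
      have : a = [] := by simp at he; exact he.1
      exact absurd (this ▸ h₂ a (by simp)) h0
  | cons a L ih =>
    intro L₂ h₁ h₂ he
    cases L₂ with
    | nil =>
      have : a = [] := by simp at he; exact he.1
      exact absurd (this ▸ h₁ a (by simp)) h0
    | cons b L' =>
      simp only [List.flatten_cons] at he
      have hab : a = b := by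
        rcases List.prefix_or_prefix_of_prefix (List.prefix_append a L.flatten)
          (he ▸ List.prefix_append b L'.flatten) with hp | hp
        · exact h a (h₁ a (by simp)) b (h₂ b (by simp)) hp
        · exact (h b (h₂ b (by simp)) a (h₁ a (by simp)) hp).symm
      subst hab
      rw [ih L' (fun w hw => h₁ w (by simp [hw])) (fun w hw => h₂ w (by simp [hw]))
        (List.append_cancel_left he)]

theorem sum_half_pow_length_le_one {S : Finset (List Bool)}
    (h : ∀ σ ∈ S, ∀ τ ∈ S, σ <+: τ → σ = τ) : ∑ σ ∈ S, (1 / 2 : ℝ) ^ σ.length ≤ 1 := by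
  by_cases h0 : [] ∈ S
  · have : S = {[]} := by
      ext σ
      simp only [Finset.mem_singleton]
      exact ⟨fun hσ => (h [] h0 σ hσ List.nil_prefix).symm, fun e => e ▸ h0⟩
    simp [this]
  · have := InformationTheory.kraft_mcmillan_inequality (S := S)
      (prefixFree_uniquelyDecodable (by simpa using h0) (by simpa using h))
    simpa using this

theorem Outputs.unique {M : Code} {σ : List Bool} {x y : ℕ} (hx : Outputs M σ x)
    (hy : Outputs M σ y) : x = y :=
  Part.mem_unique hx hy

theorem K_le_of_outputs {M : Code} {σ : List Bool} {x : ℕ} (h : Outputs M σ x) :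
    K M x ≤ σ.length :=
  iInf₂_le σ h

theorem exists_outputs_of_K {M : Code} {x : ℕ} (h : K M x ≠ ⊤) :
    ∃ σ, Outputs M σ x ∧ (σ.length : ℕ∞) = K M x := by
  have hne : Nonempty {σ // Outputs M σ x} := by
    by_contra hc
    apply h
    simp only [K]
    refine iInf₂_eq_top.2 fun σ hσ => absurd ⟨⟨σ, hσ⟩⟩ hc
  have e : K M x = ⨅ σ : {σ // Outputs M σ x}, (σ.1.length : ℕ∞) := by
    rw [K, iInf_subtype]
  obtain ⟨σ, hσ⟩ := ciInf_mem fun σ : {σ // Outputs M σ x} => (σ.1.length : ℕ∞)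
  exact ⟨σ.1, σ.2, by rw [e]; exact hσ⟩

/-- Shortest descriptions of different numbers are different strings in a prefix-free domain, so the
Kraft inequality applies. -/
theorem sum_twoPowNeg_K_le_one {M : Code} (hM : IsPrefixFree M) (F : Finset ℕ) :
    ∑ x ∈ F, (twoPowNeg (K M x) : ℝ) ≤ 1 := by
  classical
  have key : ∀ x, ∃ σ, K M x ≠ ⊤ → Outputs M σ x ∧ (σ.length : ℕ∞) = K M x := fun x => by
    by_cases h : K M x = ⊤
    · exact ⟨[], fun h' => absurd h h'⟩
    · obtain ⟨σ, hσ⟩ := exists_outputs_of_K h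
      exact ⟨σ, fun _ => hσ⟩
  choose f hf using key
  rw [← Finset.sum_filter_of_ne (p := fun x => K M x ≠ ⊤) (fun x _ hx h => hx (by simp [h]))]
  have hinj : Set.InjOn f (F.filter fun x => K M x ≠ ⊤) := by
    intro x hx y hy e
    simp only [Finset.coe_filter, Set.mem_ofPred_eq] at hx hy
    exact (hf x hx.2).1.unique (e ▸ (hf y hy.2).1)
  calc ∑ x ∈ F with K M x ≠ ⊤, (twoPowNeg (K M x) : ℝ)
      = ∑ x ∈ F with K M x ≠ ⊤, (1 / 2 : ℝ) ^ (f x).length := by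
        refine Finset.sum_congr rfl fun x hx => ?_
        rw [← (hf x (Finset.mem_filter.1 hx).2).2]
        simp
    _ = ∑ σ ∈ (F.filter fun x => K M x ≠ ⊤).image f, (1 / 2 : ℝ) ^ σ.length :=
        (Finset.sum_image (f := fun σ : List Bool => (1 / 2 : ℝ) ^ σ.length) hinj).symm
    _ ≤ 1 := by
        refine sum_half_pow_length_le_one fun σ hσ τ hτ hp => ?_
        simp only [Finset.mem_image, Finset.mem_filter] at hσ hτ
        obtain ⟨x, ⟨_, hx⟩, rfl⟩ := hσ
        obtain ⟨y, ⟨_, hy⟩, rfl⟩ := hτ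
        exact hM _ _ _ _ (hf x hx).1 (hf y hy).1 hp

/-! ### Machines from bounded request sequences -/

/-- The number with binary expansion `σ`. -/
def bitsVal (σ : List Bool) : ℕ := σ.foldl (fun a b => 2 * a + b.toNat) 0

theorem bitsVal_append_singleton (σ : List Bool) (b : Bool) :
    bitsVal (σ ++ [b]) = 2 * bitsVal σ + b.toNat := by
  simp [bitsVal]

/-- In terms of dyadic intervals: the interval of an extension lies inside the interval of `σ`. -/
theorem bitsVal_append (σ ρ : List Bool) :
    bitsVal σ * 2 ^ ρ.length ≤ bitsVal (σ ++ ρ) ∧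
      bitsVal (σ ++ ρ) < (bitsVal σ + 1) * 2 ^ ρ.length := by
  induction ρ using List.reverseRecOn with
  | nil => simp
  | append_singleton ρ b ih =>
    rw [← List.append_assoc, bitsVal_append_singleton, List.length_append, List.length_singleton,
      pow_succ]
    have : b.toNat ≤ 1 := Bool.toNat_le b
    constructor <;> nlinarith [ih.1, ih.2]

theorem exists_bitsVal (L v : ℕ) (hv : v < 2 ^ L) : ∃ σ, σ.length = L ∧ bitsVal σ = v := by
  induction L generalizing v with
  | zero => exact ⟨[], rfl, by simp at hv; simp [bitsVal, hv]⟩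
  | succ L ih =>
    obtain ⟨σ, h1, h2⟩ := ih (v / 2) (by rw [pow_succ] at hv; omega)
    refine ⟨σ ++ [decide (v % 2 = 1)], by simp [h1], ?_⟩
    rw [bitsVal_append_singleton, h2]
    by_cases h : v % 2 = 1
    · simp [h]; omega
    · simp [h]; omega

theorem primrec_pow : Primrec₂ ((· ^ ·) : ℕ → ℕ → ℕ) :=
  Primrec₂.unpaired'.1 Nat.Primrec.pow

theorem primrec_toNat : Primrec Bool.toNat := Primrec.dom_bool _

theorem primrec_bitsVal : Primrec bitsVal :=
  Primrec.list_foldl Primrec.id (Primrec.const 0)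
    (Primrec.nat_add.comp
      (Primrec.nat_mul.comp (Primrec.const 2) (Primrec.fst.comp Primrec.snd))
      (primrec_toNat.comp (Primrec.snd.comp Primrec.snd))).to₂

/-- The total weight of the first `n` requests, as numerator and exponent of a dyadic rational. -/
def dyadicSum (r : ℕ → Option ℕ) (n : ℕ) : ℕ × ℕ :=
  n.rec (0, 0) fun i p => (r i).casesOn p fun k => (p.1 * 2 ^ k + 2 ^ p.2, p.2 + k)

theorem dyadicSum_eq (r : ℕ → Option ℕ) (n : ℕ) :
    ((dyadicSum r n).1 : ℝ) / 2 ^ (dyadicSum r n).2 =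
      ∑ i ∈ Finset.range n, requestWeight (r i) := by
  induction n with
  | zero => simp [dyadicSum]
  | succ n ih =>
    rw [Finset.sum_range_succ, ← ih]
    have : dyadicSum r (n + 1) = (r n).casesOn (dyadicSum r n) fun k =>
      ((dyadicSum r n).1 * 2 ^ k + 2 ^ (dyadicSum r n).2, (dyadicSum r n).2 + k) := rfl
    rw [this]
    cases r n with
    | none => simp
    | some k =>
      simp only [requestWeight_some]
      push_cast
      rw [pow_add, one_div, inv_pow]
      field_simp

theorem computable_dyadicSum {r : ℕ → Option ℕ} (hr : Computable r) :
    Computable (dyadicSum r) := by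
  refine (Computable.nat_rec (f := fun n : ℕ => n) (g := fun _ => ((0, 0) : ℕ × ℕ))
    (h := fun _ q => (r q.1).casesOn q.2 fun k => (q.2.1 * 2 ^ k + 2 ^ q.2.2, q.2.2 + k))
    Computable.id (Computable.const (0, 0)) ?_)
  refine Computable.option_casesOn (hr.comp (Computable.fst.comp Computable.snd))
    (Computable.snd.comp Computable.snd) ?_
  refine Primrec.to_comp (f := fun q : (ℕ × ℕ × (ℕ × ℕ)) × ℕ =>
    (q.1.2.2.1 * 2 ^ q.2 + 2 ^ q.1.2.2.2, q.1.2.2.2 + q.2)) ?_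
  have h : Primrec fun q : (ℕ × ℕ × (ℕ × ℕ)) × ℕ => q.1.2.2 :=
    Primrec.snd.comp (Primrec.snd.comp Primrec.fst)
  exact Primrec.pair
    (Primrec.nat_add.comp
      (Primrec.nat_mul.comp (Primrec.fst.comp h) (primrec_pow.comp (Primrec.const 2) Primrec.snd))
      (primrec_pow.comp (Primrec.const 2) (Primrec.snd.comp h)))
    (Primrec.nat_add.comp (Primrec.snd.comp h) Primrec.snd)

/-- The string `σ` is the one allotted to the request of length `k` made after requests of total
weight `p.1 / 2 ^ p.2`. -/
def allots (p : ℕ × ℕ) (k : ℕ) (σ : List Bool) : Bool :=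
  decide (σ.length = k + 1) && (decide (p.1 * 2 ^ (k + 1) ≤ bitsVal σ * 2 ^ p.2) &&
    decide (bitsVal σ * 2 ^ p.2 < p.1 * 2 ^ (k + 1) + 2 ^ p.2))

theorem allots_iff {p : ℕ × ℕ} {k : ℕ} {σ : List Bool} :
    allots p k σ = true ↔ σ.length = k + 1 ∧ p.1 * 2 ^ (k + 1) ≤ bitsVal σ * 2 ^ p.2 ∧
      bitsVal σ * 2 ^ p.2 < p.1 * 2 ^ (k + 1) + 2 ^ p.2 := by
  simp [allots]

theorem primrec_allots :
    Primrec fun q : (ℕ × ℕ) × ℕ × List Bool => allots q.1 q.2.1 q.2.2 := by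
  have hk : Primrec fun q : (ℕ × ℕ) × ℕ × List Bool => q.2.1 + 1 :=
    Primrec.succ.comp (Primrec.fst.comp Primrec.snd)
  have hs : Primrec fun q : (ℕ × ℕ) × ℕ × List Bool => q.2.2 := Primrec.snd.comp Primrec.snd
  have hD : Primrec fun q : (ℕ × ℕ) × ℕ × List Bool => 2 ^ q.1.2 :=
    primrec_pow.comp (Primrec.const 2) (Primrec.snd.comp Primrec.fst)
  have hN : Primrec fun q : (ℕ × ℕ) × ℕ × List Bool => q.1.1 * 2 ^ (q.2.1 + 1) :=
    Primrec.nat_mul.comp (Primrec.fst.comp Primrec.fst) (primrec_pow.comp (Primrec.const 2) hk)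
  have hv : Primrec fun q : (ℕ × ℕ) × ℕ × List Bool => bitsVal q.2.2 * 2 ^ q.1.2 :=
    Primrec.nat_mul.comp (primrec_bitsVal.comp hs) hD
  exact Primrec.and.comp
    (primrecPred_iff_primrec_decide.1 (Primrec.eq.comp (Primrec.list_length.comp hs) hk))
    (Primrec.and.comp (primrecPred_iff_primrec_decide.1 (Primrec.nat_le.comp hN hv))
      (primrecPred_iff_primrec_decide.1 (Primrec.nat_lt.comp hv (Primrec.nat_add.comp hN hD))))

theorem exists_allots {p : ℕ × ℕ} {k : ℕ} (h : (p.1 : ℝ) / 2 ^ p.2 + (1 / 2) ^ k ≤ 1) :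
    ∃ σ, allots p k σ := by
  -- This rounds the weight used so far up to the grid of mesh `2 ^ (-(k + 1))`. The rounding loses
  -- less than one mesh, and the reserved length `2 ^ (-k)` is two meshes.
  set v := (p.1 * 2 ^ (k + 1) + (2 ^ p.2 - 1)) / 2 ^ p.2 with hv
  have hD : 0 < 2 ^ p.2 := by positivity
  have h1 : v * 2 ^ p.2 ≤ p.1 * 2 ^ (k + 1) + (2 ^ p.2 - 1) := Nat.div_mul_le_self _ _
  have h2 : p.1 * 2 ^ (k + 1) + (2 ^ p.2 - 1) < (v + 1) * 2 ^ p.2 := by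
    rw [add_mul, one_mul, mul_comm v]
    exact Nat.lt_mul_div_succ _ hD |>.trans_eq (by rw [mul_add, mul_one])
  have hlt : v < 2 ^ (k + 1) := by
    have h3 : p.1 * 2 ^ (k + 1) + 2 * 2 ^ p.2 ≤ 2 ^ (k + 1) * 2 ^ p.2 := by
      have : (p.1 : ℝ) * 2 ^ (k + 1) + 2 * 2 ^ p.2 ≤ 2 ^ (k + 1) * 2 ^ p.2 := by
        have := mul_le_mul_of_nonneg_right h (by positivity : (0 : ℝ) ≤ 2 ^ (k + 1) * 2 ^ p.2)
        rw [one_mul] at this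
        refine le_trans (le_of_eq ?_) this
        rw [one_div, inv_pow, pow_succ]
        field_simp
      exact_mod_cast this
    by_contra hc
    have := Nat.mul_le_mul_right (2 ^ p.2) (not_lt.1 hc)
    omega
  obtain ⟨σ, hl, hb⟩ := exists_bitsVal _ _ hlt
  refine ⟨σ, allots_iff.2 ⟨hl, ?_, ?_⟩⟩ <;> rw [hb]
  · rw [add_mul] at h2; omega
  · omega

/-- The dyadic interval of an allotted string stays inside the half-open interval reserved for its
request. Reserved intervals of different requests are disjoint, which makes the allotted strings
incomparable. -/
theorem allots_bounds {p : ℕ × ℕ} {k : ℕ} {σ τ : List Bool} (h : allots p k σ) (hp : σ <+: τ) :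
    (p.1 : ℝ) / 2 ^ p.2 ≤ bitsVal τ / 2 ^ τ.length ∧
      (bitsVal τ : ℝ) / 2 ^ τ.length < p.1 / 2 ^ p.2 + (1 / 2) ^ k := by
  obtain ⟨hl, h1, h2⟩ := allots_iff.1 h
  obtain ⟨ρ, rfl⟩ := hp
  obtain ⟨h3, h4⟩ := bitsVal_append σ ρ
  have h1' : (p.1 : ℝ) * 2 ^ (k + 1) ≤ bitsVal σ * 2 ^ p.2 := by exact_mod_cast h1
  have h2' : (bitsVal σ : ℝ) * 2 ^ p.2 < p.1 * 2 ^ (k + 1) + 2 ^ p.2 := by exact_mod_cast h2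
  have h3' : (bitsVal σ : ℝ) * 2 ^ ρ.length ≤ bitsVal (σ ++ ρ) := by exact_mod_cast h3
  have h4' : (bitsVal (σ ++ ρ) : ℝ) < (bitsVal σ + 1) * 2 ^ ρ.length := by exact_mod_cast h4
  have e : (p.1 : ℝ) / 2 ^ p.2 + (1 / 2) ^ k = (p.1 * 2 ^ k + 2 ^ p.2) / (2 ^ p.2 * 2 ^ k) := by
    rw [one_div, inv_pow]; field_simp
  have hk : (0 : ℝ) < 2 ^ k := by positivity
  have hD : (0 : ℝ) < 2 ^ p.2 := by positivity
  have hR : (0 : ℝ) < 2 ^ ρ.length := by positivity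
  rw [List.length_append, hl, e, pow_add 2 (k + 1), pow_succ 2 k]
  rw [pow_succ] at h1' h2'
  constructor
  · rw [div_le_div_iff₀ (by positivity) (by positivity)]
    calc (p.1 : ℝ) * (2 ^ k * 2 * 2 ^ ρ.length) = p.1 * (2 ^ k * 2) * 2 ^ ρ.length := by ring
      _ ≤ bitsVal σ * 2 ^ p.2 * 2 ^ ρ.length := by gcongr
      _ = bitsVal σ * 2 ^ ρ.length * 2 ^ p.2 := by ring
      _ ≤ _ := by gcongr
  · rw [div_lt_div_iff₀ (by positivity) (by positivity)]
    calc (bitsVal (σ ++ ρ) : ℝ) * (2 ^ p.2 * 2 ^ k)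
        < (bitsVal σ + 1) * 2 ^ ρ.length * (2 ^ p.2 * 2 ^ k) := by gcongr
      _ = (bitsVal σ * 2 ^ p.2 + 2 ^ p.2) * (2 ^ k * 2 ^ ρ.length) := by ring
      _ ≤ (p.1 * (2 ^ k * 2) + 2 ^ p.2 + 2 ^ p.2) * (2 ^ k * 2 ^ ρ.length) := by gcongr
      _ = _ := by ring

theorem computable_allots {r : ℕ → Option ℕ} (hr : Computable r) :
    Computable₂ fun (σ : List Bool) (n : ℕ) =>
      ((r n).casesOn false fun k => allots (dyadicSum r n) k σ : Bool) := by
  have h1 : Computable fun q : (List Bool × ℕ) × ℕ => (dyadicSum r q.1.2, q.2, q.1.1) :=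
    ((computable_dyadicSum hr).comp (Computable.snd.comp Computable.fst)).pair
      (Computable.snd.pair (Computable.fst.comp Computable.fst))
  exact Computable.option_casesOn (hr.comp Computable.snd) (Computable.const false)
    (primrec_allots.to_comp.comp h1).to₂

/-- The Kraft–Chaitin theorem, with one bit lost to alignment. On `σ` the machine searches for the
request to which `σ` is allotted and then computes its output; since that computation may diverge,
requests need not have an output. -/
theorem exists_prefixFree_of_requests {r : ℕ → Option ℕ} (hr : Computable r) {x : ℕ →. ℕ}
    (hx : Partrec x) (hs : ∀ n, ∑ i ∈ Finset.range n, requestWeight (r i) ≤ 1) :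
    ∃ M, IsPrefixFree M ∧ ∀ n k y, r n = some k → y ∈ x n → K M y ≤ k + 1 := by
  let hit : List Bool → ℕ → Bool := fun σ n =>
    (r n).casesOn false fun k => allots (dyadicSum r n) k σ
  have hhit : ∀ {σ n}, hit σ n = true ↔ ∃ k, r n = some k ∧ allots (dyadicSum r n) k σ := by
    intro σ n
    simp only [hit]
    cases r n <;> simp
  have hinj : ∀ {σ τ n m}, hit σ n = true → hit τ m = true → σ <+: τ → σ = τ ∧ n = m := by
    intro σ τ n m hn hm hp
    obtain ⟨k, hk, ha⟩ := hhit.1 hn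
    obtain ⟨l, hl, hb⟩ := hhit.1 hm
    have h1 := allots_bounds ha hp
    have h2 := allots_bounds hb (List.prefix_refl τ)
    rw [dyadicSum_eq] at h1 h2
    have hmono := Finset.sum_mono_set_of_nonneg (f := fun i => requestWeight (r i))
      (fun i => requestWeight_nonneg _)
    have e : n = m := by
      rcases lt_trichotomy n m with h | h | h
      · have := hmono (Finset.range_mono (Nat.succ_le_of_lt h))
        simp only [Nat.succ_eq_add_one, Finset.sum_range_succ, hk, requestWeight_some] at this
        linarith [h1.2, h2.1]
      · exact h
      · have := hmono (Finset.range_mono (Nat.succ_le_of_lt h))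
        simp only [Nat.succ_eq_add_one, Finset.sum_range_succ, hl, requestWeight_some] at this
        linarith [h2.2, h1.1]
    subst e
    rw [hk] at hl
    cases hl
    exact ⟨hp.eq_of_length ((allots_iff.1 ha).1.trans (allots_iff.1 hb).1.symm), rfl⟩
  have hcomp : Computable₂ hit := computable_allots hr
  have hpart : Partrec fun σ : List Bool => (Nat.rfind fun n => Part.some (hit σ n)).bind x :=
    (Partrec.rfind hcomp.partrec₂).bind (hx.comp Computable.snd)
  have hpart' : Partrec fun a : ℕ => ((decode (α := List Bool) a : Option (List Bool)) :
      Part (List Bool)).bind fun σ => (Nat.rfind fun n => Part.some (hit σ n)).bind x :=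
    (Computable.ofOption Computable.decode).bind (hpart.comp Computable.snd)
  obtain ⟨M, hM⟩ := Code.exists_code.1 (Partrec.nat_iff.1 hpart')
  have hout : ∀ {σ y}, Outputs M σ y ↔
      ∃ n ∈ Nat.rfind (fun n => Part.some (hit σ n)), y ∈ x n := by
    intro σ y
    simp only [Outputs, hM, encodek, Part.coe_some, Part.bind_some]
    exact Part.mem_bind_iff
  refine ⟨M, ?_, ?_⟩
  · intro σ τ y z hy hz hp
    obtain ⟨n, hn, -⟩ := hout.1 hy
    obtain ⟨m, hm, -⟩ := hout.1 hz
    have h1 := Nat.rfind_spec hn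
    have h2 := Nat.rfind_spec hm
    simp only [Part.mem_some_iff] at h1 h2
    exact (hinj h1.symm h2.symm hp).1
  · intro n k y hk hy
    obtain ⟨σ, hσ⟩ := exists_allots (p := dyadicSum r n) (k := k) (by
      rw [dyadicSum_eq]
      have := hs (n + 1)
      rwa [Finset.sum_range_succ, hk, requestWeight_some] at this)
    have hn : hit σ n = true := hhit.2 ⟨k, hk, hσ⟩
    obtain ⟨m, hm, -⟩ := Nat.rfind_min' (p := hit σ) hn
    have h2 := Nat.rfind_spec hm
    replace h2 : true = hit σ m := Part.mem_some_iff.1 h2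
    obtain ⟨-, rfl⟩ := hinj hn h2.symm (List.prefix_refl σ)
    have := K_le_of_outputs (hout.2 ⟨n, hm, hy⟩)
    rw [(allots_iff.1 hσ).1] at this
    exact_mod_cast this

/-- Lengthening all requests by a constant `c` brings any finite total weight below one;
universality then transfers the bound to `U`. -/
theorem IsUniversal.exists_K_le {U : Code} (hU : IsUniversal U) {r : ℕ → Option ℕ}
    (hr : Computable r) {x : ℕ →. ℕ} (hx : Partrec x)
    (hs : Summable fun n => requestWeight (r n)) :
    ∃ c : ℕ, ∀ n k y, r n = some k → y ∈ x n → K U y ≤ k + c := by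
  obtain ⟨c, hc⟩ := pow_unbounded_of_one_lt (∑' n, requestWeight (r n)) (one_lt_two (α := ℝ))
  have hr' : Computable fun n => (r n).map (· + c) :=
    Computable.option_map hr (Primrec.nat_add.comp Primrec.snd (Primrec.const c)).to_comp
  have hw : ∀ o : Option ℕ, requestWeight (o.map (· + c)) = requestWeight o * (1 / 2) ^ c := by
    intro o
    cases o <;> simp [pow_add]
  obtain ⟨M, hM, hMK⟩ := exists_prefixFree_of_requests hr' hx (fun n => by
    simp only [hw, ← Finset.sum_mul]
    have := hs.sum_le_tsum (Finset.range n) (fun i _ => requestWeight_nonneg _)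
    rw [one_div, inv_pow, ← div_eq_mul_inv, div_le_one (by positivity)]
    linarith)
  obtain ⟨d, hd⟩ := hU.2 M hM
  refine ⟨c + 1 + d, fun n k y hk hy => (hd y).trans ?_⟩
  have := hMK n (k + c) y (by simp [hk]) hy
  calc K M y + d ≤ ((k + c : ℕ) : ℕ∞) + 1 + d := by gcongr
    _ = _ := by push_cast; ring

/-! ### Bounded minima and sums -/

/-- The minimum of `b` and the values `f i` for `i < n`. -/
def boundedMin (f : ℕ → ℕ) (b n : ℕ) : ℕ := n.rec b fun i m => min m (f i)

theorem boundedMin_le_iff {f : ℕ → ℕ} {b n c : ℕ} :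
    boundedMin f b n ≤ c ↔ b ≤ c ∨ ∃ i < n, f i ≤ c := by
  induction n with
  | zero => simp [boundedMin]
  | succ n ih =>
    have : boundedMin f b (n + 1) = min (boundedMin f b n) (f n) := rfl
    rw [this, min_le_iff, ih, or_assoc]
    refine or_congr Iff.rfl ⟨?_, ?_⟩
    · rintro (⟨i, hi, h⟩ | h)
      · exact ⟨i, by omega, h⟩
      · exact ⟨n, by omega, h⟩
    · rintro ⟨i, hi, h⟩
      rcases Nat.lt_succ_iff_lt_or_eq.1 hi with h' | rfl
      · exact Or.inl ⟨i, h', h⟩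
      · exact Or.inr h

section Primrec

variable {α : Type*} [Primcodable α]

theorem primrec_boundedMin {f : α → ℕ → ℕ} {b n : α → ℕ} (hf : Primrec₂ f) (hb : Primrec b)
    (hn : Primrec n) : Primrec fun a => boundedMin (f a) (b a) (n a) :=
  Primrec.nat_rec' hn hb (Primrec.nat_min.comp (Primrec.snd.comp Primrec.snd)
    (hf.comp Primrec.fst (Primrec.fst.comp Primrec.snd))).to₂

theorem primrec_sum_range {f : α → ℕ → ℕ} {n : α → ℕ} (hf : Primrec₂ f) (hn : Primrec n) :
    Primrec fun a => ∑ i ∈ Finset.range (n a), f a i := by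
  have : Primrec fun a => ((n a).rec 0 fun i m => m + f a i : ℕ) :=
    Primrec.nat_rec' hn (Primrec.const 0) (Primrec.nat_add.comp (Primrec.snd.comp Primrec.snd)
      (hf.comp Primrec.fst (Primrec.fst.comp Primrec.snd))).to₂
  refine this.of_eq fun a => ?_
  induction n a with
  | zero => rfl
  | succ k ih => rw [Finset.sum_range_succ, ← ih]

theorem primrec_two_pow {f : α → ℕ} (hf : Primrec f) : Primrec fun a => 2 ^ f a :=
  primrec_pow.comp (Primrec.const 2) hf

end Primrec

/-! ### Computing the complexities at a stage -/

/-- The length of the string with code `n` if this is a description of `w` at stage `s`, and `s`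
otherwise. -/
def descLength (U : Code) (s w n : ℕ) : ℕ :=
  if U.evaln s n = some w ∧ w < s then
    ((decode₂ (List Bool) n).map List.length).getD s else s

/-- `K_s(w)`, with the value `s` for `∞`. -/
def stageLength (U : Code) (s w : ℕ) : ℕ := boundedMin (descLength U s w) s s

/-- The value of a bounded search for a length: values not below the bound stand for `∞`. -/
def capped (s k : ℕ) : ℕ∞ := if k < s then (k : ℕ∞) else ⊤

theorem length_le_encode (σ : List Bool) : σ.length ≤ encode σ := by
  induction σ with
  | nil => simp
  | cons a l ih =>
    rw [encode_list_cons, List.length_cons, Nat.succ_le_succ_iff]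
    exact ih.trans (Nat.right_le_pair _ _)

/-- Bounded evaluation accepts only inputs with code below the bound. Thus the value `s` never
occurs as a true length at stage `s` and can stand for `∞`. -/
theorem OutputsBy.length_lt {U : Code} {s : ℕ} {σ : List Bool} {w : ℕ} (h : OutputsBy U s σ w) :
    σ.length < s :=
  (length_le_encode σ).trans_lt (Code.evaln_bound h)

theorem OutputsBy.outputs {U : Code} {s : ℕ} {σ : List Bool} {w : ℕ} (h : OutputsBy U s σ w) :
    Outputs U σ w :=
  Code.evaln_sound h

theorem stageLength_le_iff {U : Code} {s w k : ℕ} :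
    stageLength U s w ≤ k ↔ s ≤ k ∨ w < s ∧ ∃ σ, OutputsBy U s σ w ∧ σ.length ≤ k := by
  rw [stageLength, boundedMin_le_iff]
  constructor
  · rintro (h | ⟨n, hn, h⟩)
    · exact Or.inl h
    · rw [descLength] at h
      split_ifs at h with hc
      · cases hd : decode₂ (List Bool) n with
        | none => rw [hd] at h; exact Or.inl h
        | some σ =>
          rw [hd] at h
          have hen : encode σ = n := mem_decode₂.1 hd
          exact Or.inr ⟨hc.2, σ, by rw [OutputsBy, hen]; exact hc.1, h⟩
      · exact Or.inl h
  · rintro (h | ⟨hw, σ, ho, h⟩)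
    · exact Or.inl h
    · refine Or.inr ⟨encode σ, Code.evaln_bound ho, ?_⟩
      rw [descLength, if_pos ⟨ho, hw⟩, decode₂_encode]
      exact h

theorem KStage_le_iff {U : Code} {s w k : ℕ} :
    KStage U s w ≤ k ↔ w < s ∧ ∃ σ, OutputsBy U s σ w ∧ σ.length ≤ k := by
  rw [KStage]
  split_ifs with hw
  · constructor
    · intro h
      refine ⟨hw, ?_⟩
      by_contra hc
      push Not at hc
      have : ((k + 1 : ℕ) : ℕ∞) ≤ ⨅ (σ : List Bool) (_ : OutputsBy U s σ w), (σ.length : ℕ∞) :=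
        le_iInf₂ fun σ hσ => by exact_mod_cast hc σ hσ
      have := this.trans h
      norm_cast at this
      omega
    · rintro ⟨-, σ, ho, h⟩
      exact (iInf₂_le σ ho).trans (by exact_mod_cast h)
  · simp [hw]

theorem capped_le_iff {s a k : ℕ} : capped s a ≤ k ↔ a < s ∧ a ≤ k := by
  rw [capped]
  split_ifs with h <;> simp [h]

theorem eq_of_forall_le_coe_iff {a b : ℕ∞} (h : ∀ k : ℕ, a ≤ k ↔ b ≤ k) : a = b := by
  refine le_antisymm ?_ ?_
  · induction b using ENat.recTopCoe with
    | top => exact le_top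
    | coe b => exact (h b).2 le_rfl
  · induction a using ENat.recTopCoe with
    | top => exact le_top
    | coe a => exact (h a).1 le_rfl

theorem KStage_eq_capped (U : Code) (s w : ℕ) : KStage U s w = capped s (stageLength U s w) := by
  refine eq_of_forall_le_coe_iff fun k => ?_
  rw [KStage_le_iff, capped_le_iff]
  constructor
  · rintro ⟨hw, σ, ho, h⟩
    have h1 : stageLength U s w ≤ σ.length := stageLength_le_iff.2 (Or.inr ⟨hw, σ, ho, le_rfl⟩)
    exact ⟨h1.trans_lt ho.length_lt, h1.trans h⟩
  · rintro ⟨h1, h2⟩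
    rcases stageLength_le_iff.1 (le_refl (stageLength U s w)) with h | ⟨hw, σ, ho, h⟩
    · omega
    · exact ⟨hw, σ, ho, h.trans h2⟩

/-- The least value of `K_s(w)` over `x < w ≤ s`, with the value `s` for `∞`. -/
def stageLengthAbove (U : Code) (x s : ℕ) : ℕ :=
  boundedMin (fun w => if x < w then stageLength U s w else s) s (s + 1)

theorem stageLengthAbove_le_iff {U : Code} {x s k : ℕ} : stageLengthAbove U x s ≤ k ↔
    s ≤ k ∨ ∃ w ∈ Finset.Ioc x s, stageLength U s w ≤ k := by
  rw [stageLengthAbove, boundedMin_le_iff]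
  simp only [Finset.mem_Ioc]
  constructor
  · rintro (h | ⟨w, hw, h⟩)
    · exact Or.inl h
    · split_ifs at h with hx
      · exact Or.inr ⟨w, ⟨hx, by omega⟩, h⟩
      · exact Or.inl h
  · rintro (h | ⟨w, ⟨hx, hw⟩, h⟩)
    · exact Or.inl h
    · exact Or.inr ⟨w, by omega, by rwa [if_pos hx]⟩

theorem cMax_eq (U : Code) (x s : ℕ) :
    cMax U x s = twoPowNeg (capped s (stageLengthAbove U x s)) := by
  refine le_antisymm (Finset.sup_le fun w hw => twoPowNeg_anti ?_) ?_
  · rw [KStage_eq_capped, capped, capped]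
    have : stageLengthAbove U x s ≤ stageLength U s w :=
      stageLengthAbove_le_iff.2 (Or.inr ⟨w, hw, le_rfl⟩)
    split_ifs with h1 h2 h2
    · exact_mod_cast this
    · exact le_top
    · omega
    · exact le_rfl
  · rw [capped]
    split_ifs with h
    · rcases stageLengthAbove_le_iff.1 (le_refl (stageLengthAbove U x s)) with h1 | ⟨w, hw, h1⟩
      · omega
      · refine le_trans (twoPowNeg_anti ?_)
          (Finset.le_sup (f := fun w => twoPowNeg (KStage U s w)) hw)
        rw [KStage_eq_capped, capped_le_iff]
        exact ⟨h1.trans_lt h, h1⟩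
    · simp

/-- The number `2 ^ s * 2 ^ (-K_s(w))`. -/
def scaledWeight (s k : ℕ) : ℕ := if k < s then 2 ^ (s - k) else 0

theorem scaledWeight_eq (s k : ℕ) :
    (scaledWeight s k : ℝ) = 2 ^ s * (twoPowNeg (capped s k) : ℝ) := by
  rw [scaledWeight, capped]
  split_ifs with h
  · rw [twoPowNeg_coe]
    push_cast
    rw [one_div, inv_pow, pow_sub₀ _ two_ne_zero h.le]
  · simp

section Primrec

theorem primrec_descLength (U : Code) :
    Primrec fun q : (ℕ × ℕ) × ℕ => descLength U q.1.1 q.1.2 q.2 := by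
  have hs : Primrec fun q : (ℕ × ℕ) × ℕ => q.1.1 := Primrec.fst.comp Primrec.fst
  have hw : Primrec fun q : (ℕ × ℕ) × ℕ => q.1.2 := Primrec.snd.comp Primrec.fst
  have hev : Primrec fun q : (ℕ × ℕ) × ℕ => U.evaln q.1.1 q.2 :=
    Code.primrec_evaln.comp ((hs.pair (Primrec.const U)).pair Primrec.snd)
  refine Primrec.ite ((Primrec.eq.comp hev (Primrec.option_some.comp hw)).and
    (Primrec.nat_lt.comp hw hs)) ?_ hs
  exact Primrec.option_getD.comp (Primrec.option_map (Primrec.decode₂.comp Primrec.snd)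
    (Primrec.list_length.comp Primrec.snd).to₂) hs

theorem primrec_stageLength (U : Code) : Primrec fun q : ℕ × ℕ => stageLength U q.1 q.2 :=
  primrec_boundedMin (primrec_descLength U).to₂ Primrec.fst Primrec.fst

theorem primrec_stageLengthAbove (U : Code) :
    Primrec fun q : ℕ × ℕ => stageLengthAbove U q.1 q.2 := by
  refine primrec_boundedMin ?_ Primrec.snd (Primrec.succ.comp Primrec.snd)
  have hs : Primrec fun q : (ℕ × ℕ) × ℕ => q.1.2 := Primrec.snd.comp Primrec.fst
  exact (Primrec.ite (Primrec.nat_lt.comp (Primrec.fst.comp Primrec.fst) Primrec.snd)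
    ((primrec_stageLength U).comp (hs.pair Primrec.snd)) hs).to₂

theorem primrec_scaledWeight : Primrec fun q : ℕ × ℕ => scaledWeight q.1 q.2 :=
  Primrec.ite (Primrec.nat_lt.comp Primrec.snd Primrec.fst)
    (primrec_two_pow (Primrec.nat_sub.comp Primrec.fst Primrec.snd)) (Primrec.const 0)

end Primrec

/-! ### Initial segments of finite sets -/

/-- The initial segment of length `n` of the set of elements of `l`. -/
def listSeg (l : List ℕ) (n : ℕ) : List Bool := (List.range n).map fun i => decide (i ∈ l)

theorem listSeg_eq (l : List ℕ) (n : ℕ) : listSeg l n = initSeg (l.toFinset : Set ℕ) n := by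
  simp [listSeg, initSeg]

theorem initSeg_eq_iff {A B : Set ℕ} {n : ℕ} :
    initSeg A n = initSeg B n ↔ ∀ i < n, (i ∈ A ↔ i ∈ B) := by
  simp [initSeg]

theorem primrec_mem_list : PrimrecRel fun (i : ℕ) (l : List ℕ) => i ∈ l := by
  have := (PrimrecRel.exists_mem_list (R := fun a b : ℕ => a = b) Primrec.eq).swap
  refine this.of_eq fun i l => ?_
  simp [Function.swap]

theorem primrec_listSeg : Primrec fun q : List ℕ × ℕ => listSeg q.1 q.2 :=
  Primrec.list_map (Primrec.list_range.comp Primrec.snd)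
    (primrecPred_iff_primrec_decide.1
      (primrec_mem_list.comp Primrec.snd (Primrec.fst.comp Primrec.fst))).to₂

theorem primrec_g : Primrec g :=
  Primrec.list_reverse.comp ((Primrec.list_dropWhile Primrec.not).comp Primrec.list_reverse)

/-! ### Complexity of the limits of computable approximations -/

/-- The output at stage `s` for the input with code `m`, provided that it is less than `s`. -/
def stageOutput (U : Code) (s m : ℕ) : Option ℕ :=
  (U.evaln s m).bind fun w => if w < s then some w else none

theorem stageOutput_eq_some {U : Code} {s m w : ℕ} :
    stageOutput U s m = some w ↔ U.evaln s m = some w ∧ w < s := by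
  rw [stageOutput, Option.bind_eq_some_iff]
  constructor
  · rintro ⟨v, hv, h⟩
    split_ifs at h with hlt
    cases h
    exact ⟨hv, hlt⟩
  · rintro ⟨h1, h2⟩
    exact ⟨w, h1, if_pos h2⟩

theorem stageOutput_mono {U : Code} {s t m w : ℕ} (h : stageOutput U s m = some w)
    (hst : s ≤ t) : stageOutput U t m = some w := by
  rw [stageOutput_eq_some] at *
  exact ⟨Code.evaln_mono hst h.1, h.2.trans_le hst⟩

/-- A request of the length of each string, at the first stage where its output is available. -/
def newRequest (U : Code) (n : ℕ) : Option ℕ :=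
  if stageOutput U n.unpair.1 n.unpair.2 ≠ none ∧
    stageOutput U (n.unpair.1 - 1) n.unpair.2 = none then
    (decode₂ (List Bool) n.unpair.2).map List.length else none

theorem primrec_stageOutput (U : Code) : Primrec fun q : ℕ × ℕ => stageOutput U q.1 q.2 := by
  refine Primrec.option_bind (Code.primrec_evaln.comp
    ((Primrec.fst.pair (Primrec.const U)).pair Primrec.snd)) ?_
  exact (Primrec.ite (Primrec.nat_lt.comp Primrec.snd (Primrec.fst.comp Primrec.fst))
    (Primrec.option_some.comp Primrec.snd) (Primrec.const none)).to₂

theorem primrec_unpair_fst : Primrec fun n : ℕ => n.unpair.1 := Primrec.fst.comp Primrec.unpair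

theorem primrec_unpair_snd : Primrec fun n : ℕ => n.unpair.2 := Primrec.snd.comp Primrec.unpair

theorem primrec_newRequest (U : Code) : Primrec (newRequest U) := by
  have h1 : Primrec fun n : ℕ => stageOutput U n.unpair.1 n.unpair.2 :=
    (primrec_stageOutput U).comp Primrec.unpair
  have h2 : Primrec fun n : ℕ => stageOutput U (n.unpair.1 - 1) n.unpair.2 :=
    (primrec_stageOutput U).comp
      ((Primrec.nat_sub.comp primrec_unpair_fst (Primrec.const 1)).pair primrec_unpair_snd)
  exact Primrec.ite ((Primrec.eq.comp h1 (Primrec.const none)).not.and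
    (Primrec.eq.comp h2 (Primrec.const none)))
    (Primrec.option_map (Primrec.decode₂.comp primrec_unpair_snd)
      (Primrec.list_length.comp Primrec.snd).to₂) (Primrec.const none)

/-- Each string of the domain makes at most one request, at the first stage showing its output, so
the total is at most the Kraft sum of the domain. -/
theorem summable_newRequest {U : Code} (hU : IsPrefixFree U) :
    Summable fun n => requestWeight (newRequest U n) := by
  classical
  have key : ∀ n, newRequest U n ≠ none → ∃ σ, encode σ = n.unpair.2 ∧
      newRequest U n = some σ.length ∧ (∃ w, Outputs U σ w) ∧
      stageOutput U n.unpair.1 n.unpair.2 ≠ none ∧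
      stageOutput U (n.unpair.1 - 1) n.unpair.2 = none := by
    intro n hn
    rw [newRequest] at hn ⊢
    split_ifs at hn ⊢ with hc
    · cases hd : decode₂ (List Bool) n.unpair.2 with
      | none => simp [hd] at hn
      | some σ =>
        have he : encode σ = n.unpair.2 := mem_decode₂.1 hd
        obtain ⟨w, hw⟩ := Option.ne_none_iff_exists'.1 hc.1
        refine ⟨σ, he, rfl, ⟨w, ?_⟩, hc⟩
        rw [Outputs, he]
        exact Code.evaln_sound (stageOutput_eq_some.1 hw).1
    · exact absurd rfl hn
  choose! f hf1 hf2 hf3 hf4 hf5 using key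
  refine summable_of_sum_le (fun n => requestWeight_nonneg _) (c := 1) fun F => ?_
  rw [← Finset.sum_filter_of_ne (p := fun n => newRequest U n ≠ none)
    (fun n _ hn h => hn (by simp [h]))]
  have hinj : Set.InjOn f (F.filter fun n => newRequest U n ≠ none) := by
    intro a ha b hb e
    simp only [Finset.coe_filter, Set.mem_ofPred_eq] at ha hb
    have e2 : a.unpair.2 = b.unpair.2 := by rw [← hf1 a ha.2, ← hf1 b hb.2, e]
    have key : ∀ {a b : ℕ}, a.unpair.2 = b.unpair.2 → newRequest U a ≠ none →
        newRequest U b ≠ none → ¬ a.unpair.1 < b.unpair.1 := by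
      intro a b e2 ha hb hlt
      obtain ⟨w, hw⟩ := Option.ne_none_iff_exists'.1 (hf4 a ha)
      have := stageOutput_mono hw (Nat.le_sub_one_of_lt hlt)
      rw [e2, hf5 b hb] at this
      cases this
    have e1 : a.unpair.1 = b.unpair.1 :=
      le_antisymm (not_lt.1 (key e2.symm hb.2 ha.2)) (not_lt.1 (key e2 ha.2 hb.2))
    rw [← Nat.pair_unpair a, ← Nat.pair_unpair b, e1, e2]
  calc ∑ n ∈ F with newRequest U n ≠ none, requestWeight (newRequest U n)
      = ∑ n ∈ F with newRequest U n ≠ none, (1 / 2 : ℝ) ^ (f n).length :=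
        Finset.sum_congr rfl fun n hn => by
          rw [hf2 n (Finset.mem_filter.1 hn).2, requestWeight_some]
    _ = ∑ σ ∈ (F.filter fun n => newRequest U n ≠ none).image f, (1 / 2 : ℝ) ^ σ.length :=
        (Finset.sum_image (f := fun σ : List Bool => (1 / 2 : ℝ) ^ σ.length) hinj).symm
    _ ≤ 1 := by
        refine sum_half_pow_length_le_one fun σ hσ τ hτ hp => ?_
        simp only [Finset.mem_image, Finset.mem_filter] at hσ hτ
        obtain ⟨a, ⟨_, ha⟩, rfl⟩ := hσ
        obtain ⟨b, ⟨_, hb⟩, rfl⟩ := hτ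
        obtain ⟨w, hw⟩ := hf3 a ha
        obtain ⟨v, hv⟩ := hf3 b hb
        exact hU _ _ _ _ hw hv hp

/-- If `H s w` is computable with limit `L w`, and each change of `H s w` is covered by a request of
length at most `K_s(w)`, the requests having finite total weight, then `K (L w) ≤ K w + b`. -/
theorem IsUniversal.exists_K_limit_le {U : Code} (hU : IsUniversal U) {H : ℕ → ℕ → ℕ}
    (hH : Computable₂ H) {L : ℕ → ℕ} (hL : ∀ w, ∃ t, ∀ s ≥ t, H s w = L w)
    {r : ℕ → Option ℕ} (hr : Computable r) {x : ℕ → ℕ} (hx : Computable x)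
    (hs : Summable fun n => requestWeight (r n))
    (hcov : ∀ s w, H s w ≠ H (s + 1) w → stageLength U (s + 1) w < s + 1 →
      ∃ n k, r n = some k ∧ k ≤ stageLength U (s + 1) w ∧ x n = H (s + 1) w) :
    ∃ b : ℕ, ∀ w, K U (L w) ≤ K U w + b := by
  classical
  obtain ⟨b, hb⟩ := hU.exists_K_le hr hx.partrec hs
  have hx' : Computable fun n : ℕ =>
      H n.unpair.1 ((stageOutput U n.unpair.1 n.unpair.2).getD 0) :=
    hH.comp primrec_unpair_fst.to_comp
      (Primrec.option_getD.comp ((primrec_stageOutput U).comp Primrec.unpair)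
        (Primrec.const 0)).to_comp
  obtain ⟨c, hc⟩ := hU.exists_K_le (primrec_newRequest U).to_comp hx'.partrec
    (summable_newRequest hU.1)
  refine ⟨max b c, fun w => ?_⟩
  by_cases hw : K U w = ⊤
  · simp [hw]
  obtain ⟨σ, ho, hl⟩ := exists_outputs_of_K hw
  rw [← hl]
  have hex : ∃ s, stageOutput U s (encode σ) = some w := by
    obtain ⟨k, hk⟩ := Code.evaln_complete.1 ho
    exact ⟨max k (w + 1), stageOutput_eq_some.2
      ⟨Code.evaln_mono (le_max_left _ _) hk, lt_of_lt_of_le (Nat.lt_succ_self w) (le_max_right _ _)⟩⟩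
  set s₀ := Nat.find hex with hs₀
  have h₀ : stageOutput U s₀ (encode σ) = some w := Nat.find_spec hex
  set t := Nat.find (hL w) with ht
  have h₁ : ∀ s ≥ t, H s w = L w := Nat.find_spec (hL w)
  rcases le_or_gt t s₀ with hts | hts
  -- The value has already settled when `σ` first yields `w`, so the request made for `σ` at that
  -- stage has the right output.
  · have hreq : newRequest U (Nat.pair s₀ (encode σ)) = some σ.length := by
      rw [newRequest, Nat.unpair_pair, if_pos, decode₂_encode, Option.map_some]
      refine ⟨by simp [h₀], ?_⟩
      by_contra hne
      obtain ⟨v, hv⟩ := Option.ne_none_iff_exists'.1 hne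
      have hv' := stageOutput_mono hv (Nat.sub_le _ 1)
      dsimp only at hv'
      rw [h₀] at hv'
      cases hv'
      have hpos : 0 < s₀ := by
        rcases Nat.eq_zero_or_pos s₀ with h | h
        · rw [h] at h₀
          exact absurd (stageOutput_eq_some.1 h₀).2 (Nat.not_lt_zero _)
        · exact h
      exact Nat.find_min hex (m := s₀ - 1) (by omega) hv
    have := hc _ _ (L w) hreq (by
      simp only [Nat.unpair_pair, h₀, Option.getD_some, PFun.coe_val, Part.mem_some_iff]
      exact (h₁ s₀ hts).symm)
    exact this.trans (by gcongr; exact le_max_right _ _)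
  -- Otherwise the last change comes when `σ` is already visible. The request covering it is no
  -- longer than `σ` and carries the limit value.
  · obtain ⟨t', ht'⟩ : ∃ t', t = t' + 1 := ⟨t - 1, by omega⟩
    have hne : H t' w ≠ H (t' + 1) w := by
      intro e
      have hmin := Nat.find_min (hL w) (m := t') (by omega)
      apply hmin
      intro s hs'
      rcases Nat.eq_or_lt_of_le hs' with rfl | h
      · rw [e, ← ht']; exact h₁ t le_rfl
      · exact h₁ s (by omega)
    have hle : stageLength U (t' + 1) w ≤ σ.length := by
      rw [stageLength_le_iff, ← ht']
      have := stageOutput_eq_some.1 (stageOutput_mono h₀ hts.le)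
      exact Or.inr ⟨this.2, σ, this.1, le_rfl⟩
    have hlt : σ.length < t' + 1 := by
      rw [← ht']
      exact (length_le_encode σ).trans_lt (Code.evaln_bound
        (stageOutput_eq_some.1 (stageOutput_mono h₀ hts.le)).1)
    obtain ⟨n, k, hn, hk, hxn⟩ := hcov t' w hne (hle.trans_lt hlt)
    have := hb n k (L w) hn (by
      rw [PFun.coe_val, Part.mem_some_iff, hxn, ← ht']
      exact (h₁ t le_rfl).symm)
    refine this.trans ?_
    have h1 : (k : ℕ∞) ≤ σ.length := by exact_mod_cast hk.trans hle
    gcongr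
    exact le_max_left _ _

/-! ### Sets obeying the standard cost function are `K`-trivial -/

theorem changeCost_eq {c : ℕ → ℕ → ℚ≥0} {As : ℕ → Finset ℕ} {s x : ℕ} (hx : x < s)
    (hne : ¬(x ∈ As (s - 1) ↔ x ∈ As s)) (hmin : ∀ y < x, (y ∈ As (s - 1) ↔ y ∈ As s)) :
    changeCost c As s = c x s := by
  classical
  have h : ∃ x, x < s ∧ ¬(x ∈ As (s - 1) ↔ x ∈ As s) := ⟨x, hx, hne⟩
  rw [changeCost, dif_pos h]
  congr 1
  rw [Nat.find_eq_iff]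
  exact ⟨⟨hx, hne⟩, fun n hn hc => hc.2 (hmin n hn)⟩

theorem changeCost_eq_zero {c : ℕ → ℕ → ℚ≥0} {As : ℕ → Finset ℕ} {s : ℕ}
    (h : ∀ x < s, (x ∈ As (s - 1) ↔ x ∈ As s)) : changeCost c As s = 0 := by
  rw [changeCost, dif_neg]
  rintro ⟨x, hx, hne⟩
  exact hne (h x hx)

/-- A request of length `K_{s+1}(w)` if the initial segment of length `w` changes at stage
`s + 1`. -/
def segRequest (U : Code) (l : ℕ → List ℕ) (n : ℕ) : Option ℕ :=
  if listSeg (l n.unpair.1) n.unpair.2 ≠ listSeg (l (n.unpair.1 + 1)) n.unpair.2 ∧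
    stageLength U (n.unpair.1 + 1) n.unpair.2 < n.unpair.1 + 1 then
    some (stageLength U (n.unpair.1 + 1) n.unpair.2) else none

theorem computable_listSeg {l : ℕ → List ℕ} (hl : Computable l) :
    Computable₂ fun s w => listSeg (l s) w :=
  (primrec_listSeg.to_comp.comp ((hl.comp Computable.fst).pair Computable.snd)).to₂

theorem computable_segRequest (U : Code) {l : ℕ → List ℕ} (hl : Computable l) :
    Computable (segRequest U l) := by
  have h1 : Computable fun n : ℕ => listSeg (l n.unpair.1) n.unpair.2 :=
    (computable_listSeg hl).comp primrec_unpair_fst.to_comp primrec_unpair_snd.to_comp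
  have hs : Primrec fun n : ℕ => n.unpair.1 + 1 := Primrec.succ.comp primrec_unpair_fst
  have h2 : Computable fun n : ℕ => listSeg (l (n.unpair.1 + 1)) n.unpair.2 :=
    (computable_listSeg hl).comp hs.to_comp primrec_unpair_snd.to_comp
  have hk : Primrec fun n : ℕ => stageLength U (n.unpair.1 + 1) n.unpair.2 :=
    (primrec_stageLength U).comp (hs.pair primrec_unpair_snd)
  have h : Primrec fun q : ((List Bool × List Bool) × ℕ × ℕ) =>
      if q.1.1 ≠ q.1.2 ∧ q.2.1 < q.2.2 then some q.2.1 else none :=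
    Primrec.ite ((Primrec.eq.comp (Primrec.fst.comp Primrec.fst)
      (Primrec.snd.comp Primrec.fst)).not.and (Primrec.nat_lt.comp
        (Primrec.fst.comp Primrec.snd) (Primrec.snd.comp Primrec.snd)))
      (Primrec.option_some.comp (Primrec.fst.comp Primrec.snd)) (Primrec.const none)
  exact h.to_comp.comp ((h1.pair h2).pair (hk.pair hs).to_comp)

theorem stageLength_lt_imp {U : Code} {s w : ℕ} (h : stageLength U s w < s) : w < s := by
  rcases stageLength_le_iff.1 (le_refl (stageLength U s w)) with h' | h'
  · omega
  · exact h'.1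

/-- If `x` is the least change at a stage, only segments of lengths `w > x` change. Their requests
together weigh at most the sum that `cK` charges for `x`. -/
theorem summable_segRequest {U : Code} {l : ℕ → List ℕ} {As : ℕ → Finset ℕ}
    (hl : ∀ s, (l s).toFinset = As s) (h : SeqObeys As (cK U)) :
    Summable fun n => requestWeight (segRequest U l n) := by
  classical
  have hseg : ∀ s w, listSeg (l s) w ≠ listSeg (l (s + 1)) w ↔
      ∃ x < w, ¬(x ∈ As s ↔ x ∈ As (s + 1)) := by
    intro s w
    rw [listSeg_eq, listSeg_eq, hl, hl, Ne, initSeg_eq_iff]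
    push Not
    simp only [Finset.mem_coe]
  rw [← (Nat.pairEquiv).summable_iff]
  have hf : ∀ p : ℕ × ℕ, requestWeight (segRequest U l (Nat.pairEquiv p)) =
      if (∃ x < p.2, ¬(x ∈ As p.1 ↔ x ∈ As (p.1 + 1))) ∧ stageLength U (p.1 + 1) p.2 < p.1 + 1 then
        (1 / 2 : ℝ) ^ stageLength U (p.1 + 1) p.2 else 0 := by
    rintro ⟨s, w⟩
    simp only [segRequest, Nat.pairEquiv_apply, Function.uncurry_apply_pair, Nat.unpair_pair, hseg]
    split_ifs <;> simp
  -- By convention the stage complexity of `w ≥ s + 1` is infinite, so only finitely many `w` matter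
  -- at each stage.
  have hz : ∀ s w, w ∉ Finset.range (s + 1) →
      requestWeight (segRequest U l (Nat.pairEquiv (s, w))) = 0 := by
    intro s w hw
    rw [hf, if_neg]
    rintro ⟨-, h2⟩
    exact hw (Finset.mem_range.2 (stageLength_lt_imp h2))
  refine (summable_prod_of_nonneg fun p => requestWeight_nonneg _).2 ⟨fun s =>
    summable_of_ne_finset_zero (s := Finset.range (s + 1)) (hz s), ?_⟩
  refine Summable.of_nonneg_of_le (fun s => tsum_nonneg fun w => requestWeight_nonneg _) ?_
    ((summable_nat_add_iff 1).2 h)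
  intro s
  rw [tsum_eq_sum (hz s)]
  by_cases hex : ∃ x, x < s + 1 ∧ ¬(x ∈ As s ↔ x ∈ As (s + 1))
  · have hx := Nat.find_spec hex
    have hmin : ∀ y < Nat.find hex, (y ∈ As s ↔ y ∈ As (s + 1)) := fun y hy => by
      by_contra hc
      exact Nat.find_min hex hy ⟨hy.trans hx.1, hc⟩
    rw [changeCost_eq (s := s + 1) hx.1 hx.2 hmin, cK]
    push_cast
    rw [← Finset.sum_filter_of_ne (p := fun w => w ∈ Finset.Ioc (Nat.find hex) (s + 1))]
    · refine (Finset.sum_le_sum fun w hw => ?_).trans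
        (Finset.sum_le_sum_of_subset_of_nonneg (fun w hw => (Finset.mem_filter.1 hw).2)
          fun _ _ _ => NNRat.cast_nonneg _)
      rw [hf, KStage_eq_capped, capped]
      split_ifs with h1 h2 h2
      · simp
      · exact absurd h1.2 h2
      · simp
      · simp
    · intro w hw hne
      rw [hf] at hne
      split_ifs at hne with hc
      · obtain ⟨⟨x, hx1, hx2⟩, -⟩ := hc
        rw [Finset.mem_Ioc]
        refine ⟨?_, (Finset.mem_range.1 hw).le⟩
        by_contra hle
        exact hx2 (hmin x (by omega))
      · exact absurd rfl hne
  · rw [Finset.sum_eq_zero]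
    · exact NNRat.cast_nonneg _
    · intro w hw
      rw [hf, if_neg]
      rintro ⟨⟨x, hx1, hx2⟩, -⟩
      exact hex ⟨x, hx1.trans (Finset.mem_range.1 hw), hx2⟩

theorem IsUniversal.isKTrivial_of_obeys {U : Code} (hU : IsUniversal U) {A : Set ℕ}
    (h : SetObeys A (cK U)) : IsKTrivial U A := by
  obtain ⟨As, ⟨⟨l, hl, hls⟩, hlim⟩, hob⟩ := h
  have hx : Computable fun n : ℕ => encode (listSeg (l (n.unpair.1 + 1)) n.unpair.2) :=
    Computable.encode.comp ((computable_listSeg hl).comp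
      (Primrec.succ.comp primrec_unpair_fst).to_comp primrec_unpair_snd.to_comp)
  refine hU.exists_K_limit_le (H := fun s w => encode (listSeg (l s) w))
    (Computable.encode.comp₂ (computable_listSeg hl)) ?_ (computable_segRequest U hl) hx
    (summable_segRequest hls hob) ?_
  · intro w
    choose t ht using hlim
    refine ⟨(Finset.range w).sup t, fun s hs => ?_⟩
    rw [listSeg_eq, hls, initSeg_eq_iff.2]
    intro i hi
    exact ht i s ((Finset.le_sup (Finset.mem_range.2 hi)).trans hs)
  · intro s w hne hlt
    refine ⟨Nat.pair s w, _, ?_, le_rfl, ?_⟩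
    · rw [segRequest, Nat.unpair_pair, if_pos ⟨fun e => hne (by rw [e]), hlt⟩]
    · simp only [Nat.unpair_pair]

/-! ### The construction -/

/-- The number `2 ^ s` times the sum of the weights `2 ^ (-K_s)` of the initial segments of `l` of
lengths in `(x, s]`. -/
def scaledMass (U : Code) (l : List ℕ) (s x : ℕ) : ℕ :=
  ∑ n ∈ Finset.range (s + 1),
    if x < n then scaledWeight s (stageLength U s (encode (listSeg l n))) else 0

/-- The position `x` may be put into the set with elements `l` at stage `s`: the descriptions of
initial segments that become useless outweigh the cost of this change. -/
def Qualifies (U : Code) (l : List ℕ) (s x : ℕ) : Prop :=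
  x ∉ l ∧ scaledWeight s (stageLengthAbove U x s) ≤ scaledMass U l s x ∧
    2 ^ s ≤ 2 ^ x.unpair.1 * scaledMass U l s x

instance (U : Code) (l : List ℕ) (s x : ℕ) : Decidable (Qualifies U l s x) :=
  inferInstanceAs (Decidable (_ ∧ _ ∧ _))

/-- The least position that qualifies at stage `s + 1`, and `s + 1` if there is none. -/
def nextPos (U : Code) (l : List ℕ) (s : ℕ) : ℕ :=
  boundedMin (fun x => if Qualifies U l (s + 1) x then x else s + 1) (s + 1) (s + 1)

/-- One step of the construction: put the next position into the set, and remove all larger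
elements. -/
def stepList (U : Code) (l : List ℕ) (s : ℕ) : List ℕ :=
  if nextPos U l s < s + 1 then nextPos U l s :: l.filter (fun y => y < nextPos U l s) else l

/-- The finite set built at stage `s`. -/
def stageList (U : Code) (s : ℕ) : List ℕ := s.rec [] fun s l => stepList U l s

/-- The position that is put into the set at stage `s + 1` (if this number is less than `s + 1`). -/
def actPos (U : Code) (s : ℕ) : ℕ := nextPos U (stageList U s) s

/-- The set of the elements that stay in the finite sets from some stage on. -/
def limitSet (U : Code) : Set ℕ := {x | ∃ t, ∀ s ≥ t, x ∈ stageList U s}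

section Primrec

theorem primrec_scaledMass (U : Code) :
    Primrec fun q : (List ℕ × ℕ) × ℕ => scaledMass U q.1.1 q.1.2 q.2 := by
  have hs : Primrec fun q : ((List ℕ × ℕ) × ℕ) × ℕ => q.1.1.2 :=
    Primrec.snd.comp (Primrec.fst.comp Primrec.fst)
  have hl : Primrec fun q : ((List ℕ × ℕ) × ℕ) × ℕ => q.1.1.1 :=
    Primrec.fst.comp (Primrec.fst.comp Primrec.fst)
  have he : Primrec fun q : ((List ℕ × ℕ) × ℕ) × ℕ => encode (listSeg q.1.1.1 q.2) :=
    Primrec.encode.comp (primrec_listSeg.comp (hl.pair Primrec.snd))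
  refine primrec_sum_range ?_ (Primrec.succ.comp (Primrec.snd.comp Primrec.fst))
  exact (Primrec.ite (Primrec.nat_lt.comp (Primrec.snd.comp Primrec.fst) Primrec.snd)
    (primrec_scaledWeight.comp (hs.pair ((primrec_stageLength U).comp (hs.pair he))))
    (Primrec.const 0)).to₂

theorem primrec_qualifies (U : Code) :
    PrimrecPred fun q : (List ℕ × ℕ) × ℕ => Qualifies U q.1.1 q.1.2 q.2 := by
  have hl : Primrec fun q : (List ℕ × ℕ) × ℕ => q.1.1 := Primrec.fst.comp Primrec.fst
  have hs : Primrec fun q : (List ℕ × ℕ) × ℕ => q.1.2 := Primrec.snd.comp Primrec.fst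
  have hx : Primrec fun q : (List ℕ × ℕ) × ℕ => q.2 := Primrec.snd
  refine (primrec_mem_list.comp hx hl).not.and ((Primrec.nat_le.comp
    (primrec_scaledWeight.comp (hs.pair ((primrec_stageLengthAbove U).comp (hx.pair hs))))
    (primrec_scaledMass U)).and (Primrec.nat_le.comp (primrec_two_pow hs) ?_))
  exact Primrec.nat_mul.comp (primrec_two_pow (primrec_unpair_fst.comp hx)) (primrec_scaledMass U)

theorem primrec_nextPos (U : Code) : Primrec fun q : List ℕ × ℕ => nextPos U q.1 q.2 := by
  have hs : Primrec fun q : List ℕ × ℕ => q.2 + 1 := Primrec.succ.comp Primrec.snd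
  refine primrec_boundedMin ?_ hs hs
  exact (Primrec.ite ((primrec_qualifies U).comp
    (((Primrec.fst.comp Primrec.fst).pair (hs.comp Primrec.fst)).pair Primrec.snd)) Primrec.snd
    (hs.comp Primrec.fst)).to₂

theorem primrec_stepList (U : Code) : Primrec fun q : List ℕ × ℕ => stepList U q.1 q.2 := by
  have hlt : PrimrecRel fun a b : ℕ => a < b := Primrec.nat_lt
  exact Primrec.ite (Primrec.nat_lt.comp (primrec_nextPos U) (Primrec.succ.comp Primrec.snd))
    (Primrec.list_cons.comp (primrec_nextPos U)
      (hlt.listFilter.comp Primrec.fst (primrec_nextPos U))) Primrec.fst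

theorem primrec_stageList (U : Code) : Primrec (stageList U) :=
  Primrec.nat_rec₁ (f := fun s l => stepList U l s) []
    ((primrec_stepList U).comp (Primrec.snd.pair Primrec.fst)).to₂

theorem primrec_actPos (U : Code) : Primrec (actPos U) :=
  (primrec_nextPos U).comp ((primrec_stageList U).pair Primrec.id)

end Primrec

/-! ### Lexicographic growth and convergence of the construction -/

variable {U : Code}

theorem nextPos_qualifies {l : List ℕ} {s : ℕ} (h : nextPos U l s < s + 1) :
    Qualifies U l (s + 1) (nextPos U l s) := by
  obtain ⟨x, hx, hle⟩ := (boundedMin_le_iff.1 (le_refl (nextPos U l s))).resolve_left (by omega)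
  split_ifs at hle with hq
  · have : nextPos U l s ≤ x := by
      rw [nextPos, boundedMin_le_iff]
      exact Or.inr ⟨x, hx, by rw [if_pos hq]⟩
    rwa [← le_antisymm hle this]
  · omega

theorem nextPos_le {l : List ℕ} {s x : ℕ} (hx : x < s + 1) (hq : Qualifies U l (s + 1) x) :
    nextPos U l s ≤ x := by
  rw [nextPos, boundedMin_le_iff]
  exact Or.inr ⟨x, hx, by rw [if_pos hq]⟩

theorem mem_stageList_succ {s y : ℕ} (h : actPos U s < s + 1) :
    y ∈ stageList U (s + 1) ↔ y = actPos U s ∨ y ∈ stageList U s ∧ y < actPos U s := by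
  have : stageList U (s + 1) = stepList U (stageList U s) s := rfl
  rw [this, stepList, ← actPos, if_pos h, List.mem_cons, List.mem_filter, decide_eq_true_iff]

theorem stageList_succ_of_not {s : ℕ} (h : ¬ actPos U s < s + 1) :
    stageList U (s + 1) = stageList U s := by
  have : stageList U (s + 1) = stepList U (stageList U s) s := rfl
  rw [this, stepList, ← actPos, if_neg h]

theorem actPos_notMem {s : ℕ} (h : actPos U s < s + 1) : actPos U s ∉ stageList U s :=
  (nextPos_qualifies h).1

theorem mem_stageList_succ_of_lt {s y : ℕ} (h : actPos U s < s + 1 → y < actPos U s) :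
    y ∈ stageList U (s + 1) ↔ y ∈ stageList U s := by
  by_cases ha : actPos U s < s + 1
  · rw [mem_stageList_succ ha]
    have := h ha
    constructor
    · rintro (e | e)
      · omega
      · exact e.1
    · exact fun e => Or.inr ⟨e, this⟩
  · rw [stageList_succ_of_not ha]

theorem listSeg_succ_of_le {s n : ℕ} (h : actPos U s < s + 1 → n ≤ actPos U s) :
    listSeg (stageList U (s + 1)) n = listSeg (stageList U s) n := by
  rw [listSeg, listSeg]
  refine List.map_congr_left fun i hi => ?_
  rw [decide_eq_decide]
  exact mem_stageList_succ_of_lt fun ha => (List.mem_range.1 hi).trans_le (h ha)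

theorem length_listSeg (l : List ℕ) (n : ℕ) : (listSeg l n).length = n := by simp [listSeg]

theorem listSeg_split (l : List ℕ) {x n : ℕ} (h : x < n) :
    listSeg l n = (listSeg l x ++ [decide (x ∈ l)]) ++ (listSeg l n).drop (x + 1) := by
  conv_lhs => rw [← List.take_append_drop (x + 1) (listSeg l n)]
  congr 1
  rw [listSeg, ← List.map_take, List.take_range, min_eq_left (by omega), List.range_succ,
    List.map_append]
  rfl

/-- Nothing changes below the acting position, and the digit there goes from 0 to 1; this outweighs
whatever is erased after it. -/
theorem bitsVal_listSeg_lt {s n : ℕ} (ha : actPos U s < s + 1) (hn : actPos U s < n) :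
    bitsVal (listSeg (stageList U s) n) < bitsVal (listSeg (stageList U (s + 1)) n) := by
  rw [listSeg_split _ hn, listSeg_split (stageList U (s + 1)) hn,
    listSeg_succ_of_le (n := actPos U s) fun _ => le_rfl]
  have h1 := (bitsVal_append (listSeg (stageList U s) (actPos U s) ++
    [decide (actPos U s ∈ stageList U s)])
    ((listSeg (stageList U s) n).drop (actPos U s + 1))).2
  have h2 := (bitsVal_append (listSeg (stageList U s) (actPos U s) ++
    [decide (actPos U s ∈ stageList U (s + 1))])
    ((listSeg (stageList U (s + 1)) n).drop (actPos U s + 1))).1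
  refine h1.trans_le (le_trans ?_ h2)
  rw [List.length_drop, List.length_drop, length_listSeg, length_listSeg,
    bitsVal_append_singleton, bitsVal_append_singleton]
  simp [actPos_notMem ha, (mem_stageList_succ ha).2 (Or.inl rfl)]

theorem monotone_bitsVal_listSeg (n : ℕ) :
    Monotone fun s => bitsVal (listSeg (stageList U s) n) := by
  refine monotone_nat_of_le_succ fun s => ?_
  by_cases h : actPos U s < s + 1 → n ≤ actPos U s
  · rw [listSeg_succ_of_le h]
  · push Not at h
    exact (bitsVal_listSeg_lt h.1 h.2).le

theorem exists_forall_actPos_ge (n : ℕ) : ∃ t, ∀ s ≥ t, actPos U s < s + 1 → n ≤ actPos U s := by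
  have hb : ∀ s, bitsVal (listSeg (stageList U s) n) < 2 ^ n := fun s => by
    have := (bitsVal_append [] (listSeg (stageList U s) n)).2
    simpa [bitsVal, length_listSeg] using this
  classical
  -- After a stage `t` minimizing the distance to the upper bound `2 ^ n`, a further action below
  -- `n` would make this distance smaller.
  have hex : ∃ v, ∃ t, 2 ^ n - bitsVal (listSeg (stageList U t) n) = v := ⟨_, 0, rfl⟩
  obtain ⟨t, ht⟩ := Nat.find_spec hex
  refine ⟨t, fun s hs ha => ?_⟩
  by_contra hlt
  have h1 := bitsVal_listSeg_lt ha (not_le.1 hlt)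
  have h2 : bitsVal (listSeg (stageList U t) n) ≤ bitsVal (listSeg (stageList U s) n) :=
    monotone_bitsVal_listSeg n hs
  have h3 := hb (s + 1)
  exact Nat.find_min hex (m := 2 ^ n - bitsVal (listSeg (stageList U (s + 1)) n)) (by omega)
    ⟨s + 1, rfl⟩

theorem exists_forall_mem_iff (n : ℕ) :
    ∃ t, ∀ s ≥ t, ∀ i < n, (i ∈ stageList U s ↔ i ∈ limitSet U) := by
  obtain ⟨t, ht⟩ := exists_forall_actPos_ge (U := U) n
  have hc : ∀ s ≥ t, ∀ i < n, (i ∈ stageList U s ↔ i ∈ stageList U t) := by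
    intro s hs
    induction s, hs using Nat.le_induction with
    | base => exact fun i _ => Iff.rfl
    | succ s hs ih =>
      intro i hi
      rw [mem_stageList_succ_of_lt fun ha => hi.trans_le (ht s hs ha), ih i hi]
  refine ⟨t, fun s hs i hi => ⟨fun h => ⟨t, fun s' hs' => ?_⟩, ?_⟩⟩
  · rw [hc s' hs' i hi, ← hc s hs i hi]; exact h
  · rintro ⟨t', ht'⟩
    rw [hc s hs i hi, ← hc _ (le_max_left t t') i hi]
    exact ht' _ (le_max_right _ _)

theorem listSeg_eq_initSeg_limitSet {s n : ℕ}
    (h : ∀ i < n, (i ∈ stageList U s ↔ i ∈ limitSet U)) :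
    listSeg (stageList U s) n = initSeg (limitSet U) n := by
  rw [listSeg_eq, initSeg_eq_iff]
  simpa using h

theorem isComputableApprox_limitSet :
    IsComputableApprox (fun s => (stageList U s).toFinset) (limitSet U) := by
  refine ⟨⟨stageList U, (primrec_stageList U).to_comp, fun s => rfl⟩, fun x => ?_⟩
  obtain ⟨t, ht⟩ := exists_forall_mem_iff (U := U) (x + 1)
  exact ⟨t, fun s hs => by rw [List.mem_toFinset]; exact ht s hs x (Nat.lt_succ_self x)⟩

theorem isErasing_stageList : IsErasing fun s => (stageList U s).toFinset := by
  intro x s hs hne y hxy _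
  obtain ⟨s, rfl⟩ : ∃ s', s = s' + 1 := ⟨s - 1, by omega⟩
  simp only [List.mem_toFinset, Nat.add_sub_cancel] at hne ⊢
  by_cases h : actPos U s < s + 1 → x < actPos U s
  · exact absurd (mem_stageList_succ_of_lt h) hne
  · push Not at h
    rw [mem_stageList_succ h.1]
    omega

/-! ### The weight of the initial segments abandoned -/

/-- The total weight of the descriptions at stage `s` of the initial segments of `l` of lengths
in `(x, s]`. -/
noncomputable def segMass (U : Code) (l : List ℕ) (s x : ℕ) : ℝ :=
  ∑ n ∈ Finset.Ioc x s, (twoPowNeg (KStage U s (encode (listSeg l n))) : ℝ)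

theorem scaledMass_eq (l : List ℕ) (s x : ℕ) :
    (scaledMass U l s x : ℝ) = 2 ^ s * segMass U l s x := by
  rw [scaledMass, segMass, ← Finset.sum_filter, Nat.cast_sum, Finset.mul_sum]
  have : Finset.filter (fun n => x < n) (Finset.range (s + 1)) = Finset.Ioc x s := by
    ext n
    simp only [Finset.mem_filter, Finset.mem_range, Finset.mem_Ioc]
    omega
  rw [this]
  exact Finset.sum_congr rfl fun n _ => by rw [scaledWeight_eq, KStage_eq_capped]

theorem segMass_nonneg (l : List ℕ) (s x : ℕ) : 0 ≤ segMass U l s x :=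
  Finset.sum_nonneg fun _ _ => NNRat.cast_nonneg _

theorem qualifies_iff {l : List ℕ} {s x : ℕ} :
    Qualifies U l s x ↔ x ∉ l ∧ (cMax U x s : ℝ) ≤ segMass U l s x ∧
      (1 / 2) ^ x.unpair.1 ≤ segMass U l s x := by
  have h2 : (0 : ℝ) < 2 ^ s := by positivity
  have e1 : scaledWeight s (stageLengthAbove U x s) ≤ scaledMass U l s x ↔
      (cMax U x s : ℝ) ≤ segMass U l s x := by
    rw [← Nat.cast_le (α := ℝ), scaledWeight_eq, scaledMass_eq, cMax_eq,
      mul_le_mul_iff_right₀ h2]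
  have e2 : 2 ^ s ≤ 2 ^ x.unpair.1 * scaledMass U l s x ↔
      (1 / 2 : ℝ) ^ x.unpair.1 ≤ segMass U l s x := by
    rw [← Nat.cast_le (α := ℝ)]
    push_cast
    rw [scaledMass_eq, one_div, inv_pow, inv_le_iff_one_le_mul₀' (by positivity),
      mul_left_comm, le_mul_iff_one_le_right h2]
  rw [Qualifies, e1, e2]

theorem K_le_KStage (s w : ℕ) : K U w ≤ KStage U s w := by
  induction h : KStage U s w using ENat.recTopCoe with
  | top => exact le_top
  | coe k =>
    obtain ⟨-, σ, ho, hl⟩ := KStage_le_iff.1 h.le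
    exact (K_le_of_outputs ho.outputs).trans (by exact_mod_cast hl)

/-- The weight abandoned at stage `s + 1`. -/
noncomputable def actMass (U : Code) (s : ℕ) : ℝ :=
  if actPos U s < s + 1 then segMass U (stageList U s) (s + 1) (actPos U s) else 0

theorem actMass_nonneg (s : ℕ) : 0 ≤ actMass U s := by
  rw [actMass]
  split_ifs
  · exact segMass_nonneg _ _ _
  · exact le_rfl

/-- An abandoned initial segment never returns, since the values only grow. -/
theorem listSeg_ne_of_lt {s t n : ℕ} (hst : s < t) (ha : actPos U s < s + 1)
    (hn : actPos U s < n) : listSeg (stageList U s) n ≠ listSeg (stageList U t) n := by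
  intro e
  have h1 := bitsVal_listSeg_lt ha hn
  have h2 : bitsVal (listSeg (stageList U (s + 1)) n) ≤ bitsVal (listSeg (stageList U t) n) :=
    monotone_bitsVal_listSeg n hst
  rw [e] at h1
  omega

/-- Every string is abandoned at most once: its length fixes `n`, and no abandoned segment returns.
The total is thus part of the weight of all numbers under `K U`. All three uses of the construction
draw on this one budget. -/
theorem sum_actMass_le_one (hU : IsPrefixFree U) (T : Finset ℕ) :
    ∑ s ∈ T, actMass U s ≤ 1 := by
  classical
  simp only [actMass, ← Finset.sum_filter]
  set T' := T.filter fun s => actPos U s < s + 1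
  have hT : ∀ s ∈ T', actPos U s < s + 1 := fun s hs => (Finset.mem_filter.1 hs).2
  let f : (Σ _ : ℕ, ℕ) → ℕ := fun p => encode (listSeg (stageList U p.1) p.2)
  have hinj : Set.InjOn f (T'.sigma fun s => Finset.Ioc (actPos U s) (s + 1)) := by
    rintro ⟨s, n⟩ hs ⟨t, m⟩ ht e
    simp only [Finset.coe_sigma, Set.mem_sigma_iff, Finset.mem_coe, Finset.mem_Ioc] at hs ht
    replace e : listSeg (stageList U s) n = listSeg (stageList U t) m := encode_injective e
    have hnm : n = m := by rw [← length_listSeg (stageList U s) n, e, length_listSeg]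
    subst hnm
    rcases lt_trichotomy s t with h | rfl | h
    · exact absurd e (listSeg_ne_of_lt h (hT s hs.1) hs.2.1)
    · rfl
    · exact absurd e.symm (listSeg_ne_of_lt h (hT t ht.1) ht.2.1)
  calc ∑ s ∈ T', segMass U (stageList U s) (s + 1) (actPos U s)
      ≤ ∑ s ∈ T', ∑ n ∈ Finset.Ioc (actPos U s) (s + 1), (twoPowNeg (K U (f ⟨s, n⟩)) : ℝ) := by
        refine Finset.sum_le_sum fun s _ => Finset.sum_le_sum fun n _ => ?_
        exact_mod_cast twoPowNeg_anti (K_le_KStage _ _)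
    _ = ∑ p ∈ T'.sigma fun s => Finset.Ioc (actPos U s) (s + 1), (twoPowNeg (K U (f p)) : ℝ) :=
        (Finset.sum_sigma _ _ fun p => (twoPowNeg (K U (f p)) : ℝ)).symm
    _ = ∑ w ∈ (T'.sigma fun s => Finset.Ioc (actPos U s) (s + 1)).image f,
          (twoPowNeg (K U w) : ℝ) :=
        (Finset.sum_image (f := fun w => (twoPowNeg (K U w) : ℝ)) hinj).symm
    _ ≤ 1 := sum_twoPowNeg_K_le_one hU _

theorem summable_actMass (hU : IsPrefixFree U) : Summable (actMass U) :=
  summable_of_sum_le actMass_nonneg (sum_actMass_le_one hU)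

theorem cMax_le_actMass {s : ℕ} (h : actPos U s < s + 1) :
    (cMax U (actPos U s) (s + 1) : ℝ) ≤ actMass U s := by
  rw [actMass, if_pos h]
  exact (qualifies_iff.1 (nextPos_qualifies h)).2.1

theorem seqObeys_stageList (hU : IsPrefixFree U) :
    SeqObeys (fun s => (stageList U s).toFinset) (cMax U) := by
  refine (summable_nat_add_iff 1).1 (Summable.of_nonneg_of_le
    (fun s => NNRat.cast_nonneg _) (fun s => ?_) (summable_actMass hU))
  by_cases h : actPos U s < s + 1
  · rw [changeCost_eq h]
    · exact cMax_le_actMass h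
    · simp [actPos_notMem h, (mem_stageList_succ h).2 (Or.inl rfl)]
    · intro y hy
      simp only [List.mem_toFinset, Nat.add_sub_cancel]
      exact (mem_stageList_succ_of_lt fun _ => hy).symm
  · rw [changeCost_eq_zero]
    · simpa using actMass_nonneg s
    · intro y _
      simp [stageList_succ_of_not h]

/-! ### Weak `K`-triviality -/

/-- A request for the new initial segment at an action, as long as the cheapest description
above. -/
def actRequest (U : Code) (s : ℕ) : Option ℕ :=
  if actPos U s < s + 1 ∧ stageLengthAbove U (actPos U s) (s + 1) < s + 1 then
    some (stageLengthAbove U (actPos U s) (s + 1)) else none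

theorem primrec_actRequest (U : Code) : Primrec (actRequest U) := by
  have hk : Primrec fun s => stageLengthAbove U (actPos U s) (s + 1) :=
    (primrec_stageLengthAbove U).comp ((primrec_actPos U).pair Primrec.succ)
  exact Primrec.ite ((Primrec.nat_lt.comp (primrec_actPos U) Primrec.succ).and
    (Primrec.nat_lt.comp hk Primrec.succ)) (Primrec.option_some.comp hk) (Primrec.const none)

theorem summable_actRequest (hU : IsPrefixFree U) :
    Summable fun s => requestWeight (actRequest U s) := by
  refine Summable.of_nonneg_of_le (fun s => requestWeight_nonneg _) (fun s => ?_)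
    (summable_actMass hU)
  rw [actRequest]
  split_ifs with h
  · have := cMax_le_actMass h.1
    rw [cMax_eq, capped, if_pos h.2] at this
    simpa using this
  · simpa using actMass_nonneg s

theorem g_append_of_forall_false (α β : List Bool) (h : ∀ b ∈ β, b = false) :
    g (α ++ [true] ++ β) = α ++ [true] := by
  induction β using List.reverseRecOn with
  | nil => simp [g]
  | append_singleton β b ih =>
    rw [← List.append_assoc, g, List.rdropWhile_concat, if_pos (by simp [h b (by simp)])]
    exact ih fun b' hb' => h b' (by simp [hb'])

/-- Because of the erasure, the acting position carries the last 1. -/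
theorem g_listSeg_succ {s n : ℕ} (h : actPos U s < s + 1) (hn : actPos U s < n) :
    g (listSeg (stageList U (s + 1)) n) = listSeg (stageList U (s + 1)) (actPos U s + 1) := by
  have hmem := (mem_stageList_succ h).2 (Or.inl rfl)
  rw [listSeg_split _ hn, listSeg_split (n := actPos U s + 1) _ (Nat.lt_succ_self (actPos U s)),
    List.drop_eq_nil_of_le (as := listSeg _ (actPos U s + 1)) (by rw [length_listSeg]),
    List.append_nil, decide_eq_true hmem]
  refine g_append_of_forall_false _ _ fun b hb => ?_
  obtain ⟨i, hi, rfl⟩ := List.mem_iff_getElem.1 hb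
  simp only [listSeg, List.getElem_drop, List.getElem_map, List.getElem_range,
    decide_eq_false_iff_not, mem_stageList_succ h]
  omega

theorem isWeaklyKTrivial_limitSet (hU : IsUniversal U) : IsWeaklyKTrivial U (limitSet U) := by
  have hH : Primrec₂ fun s w => encode (g (listSeg (stageList U s) w)) :=
    Primrec.encode.comp (primrec_g.comp (primrec_listSeg.comp
      (((primrec_stageList U).comp Primrec.fst).pair Primrec.snd)))
  have hx : Primrec fun s => encode (listSeg (stageList U (s + 1)) (actPos U s + 1)) :=
    Primrec.encode.comp (primrec_listSeg.comp
      (((primrec_stageList U).comp Primrec.succ).pair (Primrec.succ.comp (primrec_actPos U))))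
  refine hU.exists_K_limit_le hH.to_comp ?_ (primrec_actRequest U).to_comp hx.to_comp
    (summable_actRequest hU.1) ?_
  · intro w
    obtain ⟨t, ht⟩ := exists_forall_mem_iff (U := U) w
    exact ⟨t, fun s hs => by rw [listSeg_eq_initSeg_limitSet (ht s hs)]⟩
  · intro s w hne hlt
    by_cases h : actPos U s < s + 1 → w ≤ actPos U s
    · exact absurd (by rw [listSeg_succ_of_le h]) hne
    · push Not at h
      -- The request of this action is as short as the cheapest number above the acting position,
      -- hence short enough for every changed `w` at once. This is why a maximum replaces the sum in
      -- `cK`.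
      have hle : stageLengthAbove U (actPos U s) (s + 1) ≤ stageLength U (s + 1) w := by
        rw [stageLengthAbove, boundedMin_le_iff]
        exact Or.inr ⟨w, (stageLength_lt_imp hlt).trans (Nat.lt_succ_self _), by rw [if_pos h.2]⟩
      exact ⟨s, _, if_pos ⟨h.1, hle.trans_lt hlt⟩, hle, by rw [g_listSeg_succ h.1 h.2]⟩

/-! ### Positions outside the limit set -/

/-- An action at a position in column `y` abandons weight at least `2 ^ (-y)`, so `2 ^ y + 1` of
them would exceed the budget of one. -/
theorem exists_never_actPos (hU : IsPrefixFree U) (y : ℕ) :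
    ∃ i ≤ 2 ^ y, ∀ s, actPos U s < s + 1 → actPos U s ≠ Nat.pair y i := by
  classical
  by_contra hc
  push Not at hc
  choose! f hf1 hf2 using hc
  have hinj : Set.InjOn f (Finset.range (2 ^ y + 1)) := by
    intro i hi j hj e
    simp only [Finset.coe_range, Set.mem_Iio] at hi hj
    have h1 := hf2 i (by omega)
    rw [e, hf2 j (by omega), Nat.pair_eq_pair] at h1
    exact h1.2.symm
  have h1 := sum_actMass_le_one hU ((Finset.range (2 ^ y + 1)).image f)
  rw [Finset.sum_image hinj] at h1
  have h2 : ∑ i ∈ Finset.range (2 ^ y + 1), (1 / 2 : ℝ) ^ y ≤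
      ∑ i ∈ Finset.range (2 ^ y + 1), actMass U (f i) := by
    refine Finset.sum_le_sum fun i hi => ?_
    have hi' : i ≤ 2 ^ y := by simpa [Nat.lt_succ_iff] using hi
    rw [actMass, if_pos (hf1 i hi')]
    have := (qualifies_iff.1 (nextPos_qualifies (hf1 i hi'))).2.2
    rw [← actPos, hf2 i hi', Nat.unpair_pair] at this
    rwa [hf2 i hi']
  rw [Finset.sum_const, Finset.card_range, nsmul_eq_mul, one_div, inv_pow] at h2
  push_cast at h2
  rw [add_mul, mul_inv_cancel₀ (by positivity), one_mul] at h2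
  have : (0 : ℝ) < (2 ^ y)⁻¹ := by positivity
  linarith

theorem notMem_stageList_of_never {x : ℕ} (h : ∀ s, actPos U s < s + 1 → actPos U s ≠ x) (s : ℕ) :
    x ∉ stageList U s := by
  induction s with
  | zero => simp [stageList]
  | succ s ih =>
    by_cases ha : actPos U s < s + 1
    · rw [mem_stageList_succ ha]
      rintro (e | e)
      · exact h s ha e.symm
      · exact ih e.1
    · rwa [stageList_succ_of_not ha]

theorem exists_KStage_le (w : ℕ) : ∃ t, ∀ s ≥ t, KStage U s w ≤ K U w := by
  by_cases h : K U w = ⊤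
  · exact ⟨0, fun s _ => by simp [h]⟩
  obtain ⟨σ, ho, hl⟩ := exists_outputs_of_K h
  obtain ⟨k, hk⟩ := Code.evaln_complete.1 ho
  refine ⟨max k (w + 1), fun s hs => ?_⟩
  rw [← hl, KStage_le_iff]
  exact ⟨by omega, σ, Code.evaln_mono (by omega) hk, le_rfl⟩

/-- If `x` is never put into the set, the initial segments of the limit set of lengths above `x`
have small total weight. -/
theorem exists_sum_initSeg_lt {x : ℕ} (h : ∀ s, actPos U s < s + 1 → actPos U s ≠ x)
    {F : Finset ℕ} (hF : ∀ n ∈ F, x < n) :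
    ∃ t, ∀ s ≥ t, ∑ n ∈ F, (twoPowNeg (KStr U (initSeg (limitSet U) n)) : ℝ) <
      max (cMax U x s : ℝ) ((1 / 2) ^ x.unpair.1) := by
  classical
  obtain ⟨t₁, ht₁⟩ := exists_forall_actPos_ge (U := U) (x + 1)
  obtain ⟨t₂, ht₂⟩ := exists_forall_mem_iff (U := U) (F.sup id)
  choose t₃ ht₃ using fun n => exists_KStage_le (U := U) (encode (initSeg (limitSet U) n))
  refine ⟨t₁ + t₂ + F.sup t₃ + F.sup id + x + 1, fun s hs => ?_⟩
  obtain ⟨s, rfl⟩ : ∃ s', s = s' + 1 := ⟨s - 1, by omega⟩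
  -- If `x` qualified, the least qualifying position, which is at most `x`, would act; but no
  -- position up to `x` acts this late.
  have hq : ¬ Qualifies U (stageList U s) (s + 1) x := by
    intro hq
    have h1 : actPos U s ≤ x := nextPos_le (by omega) hq
    have h2 := ht₁ s (by omega) (by omega)
    omega
  rw [qualifies_iff] at hq
  have hlt : segMass U (stageList U s) (s + 1) x <
      max (cMax U x (s + 1) : ℝ) ((1 / 2) ^ x.unpair.1) := by
    by_contra hc
    rw [not_lt, max_le_iff] at hc
    exact hq ⟨notMem_stageList_of_never h s, hc⟩
  refine lt_of_le_of_lt ?_ hlt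
  rw [segMass]
  have hsub : F ⊆ Finset.Ioc x (s + 1) := by
    intro n hn
    have : n ≤ F.sup id := Finset.le_sup (f := id) hn
    exact Finset.mem_Ioc.2 ⟨hF n hn, by omega⟩
  refine le_trans (Finset.sum_le_sum fun n hn => ?_)
    (Finset.sum_le_sum_of_subset_of_nonneg hsub fun _ _ _ => NNRat.cast_nonneg _)
  have h1 : n ≤ F.sup id := Finset.le_sup (f := id) hn
  have h2 : t₃ n ≤ F.sup t₃ := Finset.le_sup hn
  rw [listSeg_eq_initSeg_limitSet fun i hi => ht₂ s (by omega) i (by omega)]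
  exact_mod_cast twoPowNeg_anti (ht₃ n (s + 1) (by omega))

/-! ### Sums over intervals with heavy elements -/

/-- One `w` may be the heavy element of many nested blocks, so weights are truncated at the scale of
the block. Joining two blocks of length `2 ^ a` doubles the sum, and raising the truncation to `2 ^
(a + 1) * u` gains another `2 ^ a * u` from the heavy element of the union. -/
theorem sum_min_ge_of_heavy {f : ℕ → ℝ} (hf : ∀ w, 0 ≤ f w) {t : ℕ → ℕ} {N : ℕ} {u : ℝ}
    (h : ∀ j i, j < i → i ≤ N → ∃ w ∈ Finset.Ioc (t j) (t i), ((i - j : ℕ) : ℝ) * u ≤ f w)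
    (hu : 0 ≤ u) (a : ℕ) : ∀ j, j + 2 ^ a ≤ N →
      (1 + a / 2) * 2 ^ a * u ≤
        ∑ w ∈ Finset.Ioc (t j) (t (j + 2 ^ a)), min (f w) (2 ^ a * u) := by
  have hnn : ∀ j i, j < i → i ≤ N → t j ≤ t i := fun j i h1 h2 => by
    obtain ⟨w, hw, -⟩ := h j i h1 h2
    rw [Finset.mem_Ioc] at hw
    omega
  induction a with
  | zero =>
    intro j hj
    obtain ⟨w, hw, hfw⟩ := h j (j + 1) (Nat.lt_succ_self j) hj
    have hmem : ∀ v ∈ Finset.Ioc (t j) (t (j + 2 ^ 0)), 0 ≤ min (f v) (2 ^ 0 * u) := by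
      exact fun v _ => le_min (hf v) (by simpa using hu)
    have h1 := Finset.single_le_sum hmem hw
    refine le_trans ?_ h1
    simp only [Nat.add_sub_cancel_left, Nat.cast_one, one_mul] at hfw
    simp [hfw]
  | succ a ih =>
    intro j hj
    have e : j + 2 ^ (a + 1) = j + 2 ^ a + 2 ^ a := by rw [pow_succ]; ring
    have hpos : 0 < 2 ^ a := by positivity
    have h1 := ih j (by omega)
    have h2 := ih (j + 2 ^ a) (by omega)
    obtain ⟨w₀, hw₀, hf₀⟩ := h j (j + 2 ^ (a + 1)) (by omega) hj
    have hle1 := hnn j (j + 2 ^ a) (by omega) (by omega)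
    have hle2 := hnn (j + 2 ^ a) (j + 2 ^ a + 2 ^ a) (by omega) (by omega)
    have hsum := Finset.sum_Ioc_consecutive (fun w => min (f w) (2 ^ a * u)) hle1 hle2
    rw [e] at hw₀ hf₀ ⊢
    have key : ∑ w ∈ Finset.Ioc (t j) (t (j + 2 ^ a + 2 ^ a)), (min (f w) (2 ^ a * u) +
        if w = w₀ then 2 ^ a * u else 0) ≤
        ∑ w ∈ Finset.Ioc (t j) (t (j + 2 ^ a + 2 ^ a)), min (f w) (2 ^ (a + 1) * u) := by
      refine Finset.sum_le_sum fun w _ => ?_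
      have hau : 0 ≤ 2 ^ a * u := by positivity
      have e2 : (2 : ℝ) ^ (a + 1) * u = 2 ^ a * u + 2 ^ a * u := by rw [pow_succ]; ring
      split_ifs with hw
      · subst hw
        have e3 : ((j + 2 ^ a + 2 ^ a - j : ℕ) : ℝ) * u = 2 ^ a * u + 2 ^ a * u := by
          rw [show j + 2 ^ a + 2 ^ a - j = 2 ^ a + 2 ^ a by omega]
          push_cast
          ring
        rw [e3] at hf₀
        rw [e2, min_eq_right hf₀]
        linarith [min_le_right (f w) (2 ^ a * u)]
      · rw [add_zero]
        exact min_le_min le_rfl (by linarith)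
    rw [Finset.sum_add_distrib, Finset.sum_ite_eq', if_pos hw₀, ← hsum] at key
    refine le_trans ?_ key
    refine le_trans (le_of_eq ?_) (add_le_add_left (add_le_add h1 h2) _)
    push_cast
    rw [pow_succ]
    ring

/-! ### An adaptive sequence of stages -/

/-- The number of stages considered by the `e`-th sequence is `2 ^ runExp e`. -/
def runExp (e : ℕ) : ℕ := 2 ^ (2 * e + 2)

/-- At stage `s` the weights above the elements of `l` are as large as required by the `e`-th
sequence of stages. -/
def RunReady (U : Code) (e : ℕ) (l : List ℕ) (s : ℕ) : Prop :=
  ∀ q ∈ List.range l.length, stageLengthAbove U (l.getD q 0) s < s ∧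
    (q + 1) * 2 ^ stageLengthAbove U (l.getD q 0) s ≤ 2 ^ (runExp e + 2 * e)

instance (U : Code) (e : ℕ) (l : List ℕ) (s : ℕ) : Decidable (RunReady U e l s) :=
  inferInstanceAs (Decidable (∀ q ∈ List.range l.length, _))

/-- The elements less than `s` of the `e`-th sequence of stages, in decreasing order. -/
def runList (U : Code) (e s : ℕ) : List ℕ :=
  s.rec [] fun s l => if RunReady U e l s then s :: l else l

theorem runList_succ (U : Code) (e s : ℕ) : runList U e (s + 1) =
    if RunReady U e (runList U e s) s then s :: runList U e s else runList U e s := rfl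

/-- `s` is the `i`-th stage of the `e`-th sequence. -/
def IsRunStage (U : Code) (e i s : ℕ) : Prop :=
  (runList U e s).length = i ∧ RunReady U e (runList U e s) s

instance (U : Code) (e i s : ℕ) : Decidable (IsRunStage U e i s) :=
  inferInstanceAs (Decidable (_ ∧ _))

section Primrec

theorem primrec_runReady (U : Code) :
    PrimrecPred fun q : (ℕ × List ℕ) × ℕ => RunReady U q.1.1 q.1.2 q.2 := by
  have he : Primrec fun p : ℕ × (ℕ × List ℕ) × ℕ => p.2.1.1 :=
    Primrec.fst.comp (Primrec.fst.comp Primrec.snd)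
  have hl : Primrec fun p : ℕ × (ℕ × List ℕ) × ℕ => p.2.1.2 :=
    Primrec.snd.comp (Primrec.fst.comp Primrec.snd)
  have hs : Primrec fun p : ℕ × (ℕ × List ℕ) × ℕ => p.2.2 := Primrec.snd.comp Primrec.snd
  have hk : Primrec fun p : ℕ × (ℕ × List ℕ) × ℕ =>
      stageLengthAbove U (p.2.1.2.getD p.1 0) p.2.2 :=
    (primrec_stageLengthAbove U).comp (((Primrec.list_getD 0).comp hl Primrec.fst).pair hs)
  have he2 : Primrec fun p : ℕ × (ℕ × List ℕ) × ℕ => 2 * p.2.1.1 :=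
    Primrec.nat_mul.comp (Primrec.const 2) he
  have hR : PrimrecRel fun (q : ℕ) (a : (ℕ × List ℕ) × ℕ) =>
      stageLengthAbove U (a.1.2.getD q 0) a.2 < a.2 ∧
      (q + 1) * 2 ^ stageLengthAbove U (a.1.2.getD q 0) a.2 ≤ 2 ^ (runExp a.1.1 + 2 * a.1.1) :=
    ((Primrec.nat_lt.comp hk hs).and (Primrec.nat_le.comp
      (Primrec.nat_mul.comp (Primrec.succ.comp Primrec.fst) (primrec_two_pow hk))
      (primrec_two_pow (Primrec.nat_add.comp (primrec_two_pow (Primrec.nat_add.comp he2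
        (Primrec.const 2))) he2))))
  exact hR.forall_mem_list.comp (Primrec.list_range.comp
    (Primrec.list_length.comp (Primrec.snd.comp Primrec.fst))) Primrec.id

theorem primrec_runList (U : Code) : Primrec fun q : ℕ × ℕ => runList U q.1 q.2 := by
  refine Primrec.nat_rec' (h := fun (q : ℕ × ℕ) (p : ℕ × List ℕ) =>
    if RunReady U q.1 p.2 p.1 then p.1 :: p.2 else p.2) Primrec.snd (Primrec.const []) ?_
  have hl : Primrec fun q : (ℕ × ℕ) × ℕ × List ℕ => q.2.2 := Primrec.snd.comp Primrec.snd
  have hs : Primrec fun q : (ℕ × ℕ) × ℕ × List ℕ => q.2.1 := Primrec.fst.comp Primrec.snd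
  exact (Primrec.ite ((primrec_runReady U).comp
    (((Primrec.fst.comp Primrec.fst).pair hl).pair hs)) (Primrec.list_cons.comp hs hl) hl).to₂

theorem primrec_isRunStage (U : Code) :
    PrimrecPred fun q : ℕ × ℕ => IsRunStage U q.1.unpair.1 q.1.unpair.2 q.2 := by
  have he : Primrec fun q : ℕ × ℕ => q.1.unpair.1 := primrec_unpair_fst.comp Primrec.fst
  have hi : Primrec fun q : ℕ × ℕ => q.1.unpair.2 := primrec_unpair_snd.comp Primrec.fst
  have hl : Primrec fun q : ℕ × ℕ => runList U q.1.unpair.1 q.2 :=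
    (primrec_runList U).comp (he.pair Primrec.snd)
  exact (Primrec.eq.comp (Primrec.list_length.comp hl) hi).and
    ((primrec_runReady U).comp ((he.pair hl).pair Primrec.snd))

end Primrec

/-- The tail behind an entry is the list as it stood when that entry was added, so the test passed
at that time can be recovered. -/
theorem runList_getD {e s r : ℕ} (hr : r < (runList U e s).length) :
    (runList U e s).getD r 0 < s ∧
      runList U e ((runList U e s).getD r 0) = (runList U e s).drop (r + 1) ∧
      RunReady U e (runList U e ((runList U e s).getD r 0)) ((runList U e s).getD r 0) := by
  induction s generalizing r with
  | zero => simp [runList] at hr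
  | succ s ih =>
    rw [runList_succ] at hr ⊢
    split_ifs at hr ⊢ with h
    · cases r with
      | zero => exact ⟨Nat.lt_succ_self s, by simp, h⟩
      | succ r =>
        have := ih (r := r) (by simpa using hr)
        simp only [List.getD_cons_succ, List.drop_succ_cons]
        exact ⟨this.1.trans (Nat.lt_succ_self s), this.2⟩
    · have := ih hr
      exact ⟨this.1.trans (Nat.lt_succ_self s), this.2⟩

theorem runList_getD_lt {e s r q : ℕ} (hrq : r < q) (hq : q < (runList U e s).length) :
    (runList U e s).getD q 0 < (runList U e s).getD r 0 := by
  obtain ⟨-, h2, -⟩ := runList_getD (hrq.trans hq)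
  have h3 := runList_getD (U := U) (e := e) (s := (runList U e s).getD r 0) (r := q - (r + 1))
    (by rw [h2, List.length_drop]; omega)
  have h4 := h3.1
  rw [h2] at h4
  rwa [List.getD_eq_getElem?_getD, List.getElem?_drop, Nat.add_sub_cancel' (by omega),
    ← List.getD_eq_getElem?_getD] at h4

theorem IsRunStage.unique {e i s t : ℕ} (hs : IsRunStage U e i s) (ht : IsRunStage U e i t) :
    s = t := by
  have mono : Monotone fun s => (runList U e s).length := by
    refine monotone_nat_of_le_succ fun s => ?_
    rw [runList_succ]
    split_ifs <;> simp
  have key : ∀ {s t}, IsRunStage U e i s → IsRunStage U e i t → ¬ s < t := by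
    intro s t hs ht hlt
    have := mono (Nat.succ_le_of_lt hlt)
    simp only [Nat.succ_eq_add_one, runList_succ, if_pos hs.2, List.length_cons] at this
    rw [hs.1, ht.1] at this
    omega
  exact le_antisymm (not_lt.1 (key ht hs)) (not_lt.1 (key hs ht))

/-! ### Weight placed along the sequences of stages -/

/-- A bound for the least position in the column `y` that is never put into the set. -/
def columnBound (y : ℕ) : ℕ := Nat.pair y (2 ^ y)

theorem columnBound_lt {x y : ℕ} (h : x < y) : columnBound x < columnBound y :=
  (Nat.pair_lt_pair_left _ h).trans
    (Nat.pair_lt_pair_right _ (Nat.pow_lt_pow_right (by norm_num) h))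

/-- A request for each of the first `2 ^ runExp e + 1` stages of the `e`-th sequence. -/
def runRequest (n : ℕ) : Option ℕ :=
  if n.unpair.2 < 2 ^ runExp n.unpair.1 + 1 then some (runExp n.unpair.1 + n.unpair.1) else none

theorem primrec_runRequest : Primrec runRequest := by
  have hp : Primrec fun n : ℕ => runExp n.unpair.1 :=
    primrec_two_pow (Primrec.nat_add.comp
      (Primrec.nat_mul.comp (Primrec.const 2) primrec_unpair_fst) (Primrec.const 2))
  exact Primrec.ite (Primrec.nat_lt.comp primrec_unpair_snd
    (Primrec.succ.comp (primrec_two_pow hp)))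
    (Primrec.option_some.comp (Primrec.nat_add.comp hp primrec_unpair_fst)) (Primrec.const none)

/-- With `p = runExp e`, the `e`-th sequence uses `(2 ^ p + 1) * 2 ^ (-(p + e)) ≤ 2 * 2 ^ (-e)`. -/
theorem summable_runRequest : Summable fun n => requestWeight (runRequest n) := by
  rw [← (Nat.pairEquiv).summable_iff]
  have hf : ∀ e i, requestWeight (runRequest (Nat.pairEquiv (e, i))) =
      if i < 2 ^ runExp e + 1 then (1 / 2 : ℝ) ^ (runExp e + e) else 0 := by
    intro e i
    simp only [runRequest, Nat.pairEquiv_apply, Function.uncurry_apply_pair, Nat.unpair_pair]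
    split_ifs <;> simp
  have hz : ∀ e, ∀ i ∉ Finset.range (2 ^ runExp e + 1),
      requestWeight (runRequest (Nat.pairEquiv (e, i))) = 0 := by
    intro e i hi
    rw [hf, if_neg (by simpa using hi)]
  refine (summable_prod_of_nonneg fun p => requestWeight_nonneg _).2 ⟨fun e =>
    summable_of_ne_finset_zero (hz e), ?_⟩
  refine Summable.of_nonneg_of_le (fun s => tsum_nonneg fun w => requestWeight_nonneg _) ?_
    (summable_geometric_two.mul_left 2)
  intro e
  rw [tsum_eq_sum (hz e), Finset.sum_congr rfl fun i hi => by
    rw [hf, if_pos (Finset.mem_range.1 hi)], Finset.sum_const, Finset.card_range, nsmul_eq_mul,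
    pow_add, ← mul_assoc]
  refine mul_le_mul_of_nonneg_right ?_ (by positivity)
  rw [one_div, inv_pow, ← div_eq_mul_inv, div_le_iff₀ (by positivity)]
  push_cast
  have : (1 : ℝ) ≤ 2 ^ runExp e := one_le_pow₀ one_le_two
  linarith

/-- The output of request `(e, i)` is found by searching for the `i`-th stage, which may not exist.
The constant `d` serves all sequences, so `e` can be chosen after it. -/
theorem IsUniversal.exists_K_runStage_le (hU : IsUniversal U) : ∃ d : ℕ, ∀ e i s,
    i ≤ 2 ^ runExp e → IsRunStage U e i s → K U (columnBound s + 1) ≤ (runExp e + e + d : ℕ) := by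
  have hp : Partrec fun n : ℕ => (Nat.rfind fun s =>
      Part.some (decide (IsRunStage U n.unpair.1 n.unpair.2 s))).map fun s => columnBound s + 1 := by
    have h1 : Computable₂ fun n s : ℕ => decide (IsRunStage U n.unpair.1 n.unpair.2 s) :=
      (primrecPred_iff_primrec_decide.1 (primrec_isRunStage U)).to_comp
    refine (Partrec.rfind h1.partrec₂).map ?_
    exact (Primrec.succ.comp (Primrec₂.natPair.comp Primrec.snd
      (primrec_two_pow Primrec.snd))).to_comp
  obtain ⟨d, hd⟩ := hU.exists_K_le primrec_runRequest.to_comp hp summable_runRequest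
  refine ⟨d, fun e i s hi hs => ?_⟩
  have := hd (Nat.pair e i) (runExp e + e) (columnBound s + 1)
    (by rw [runRequest, Nat.unpair_pair, if_pos (Nat.lt_succ_of_le hi)]) (by
      simp only [Nat.unpair_pair]
      refine Part.mem_map _ ?_
      obtain ⟨t, ht, -⟩ := Nat.rfind_min' (p := fun s => decide (IsRunStage U e i s))
        (m := s) (decide_eq_true hs)
      have h2 := Nat.rfind_spec ht
      have h3 : true = decide (IsRunStage U e i t) := Part.mem_some_iff.1 h2
      rw [hs.unique (of_decide_eq_true h3.symm)]
      exact ht)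
  push_cast at this ⊢
  exact this

/-! ### The limit set is not `K`-trivial -/

theorem cMax_anti {x y : ℕ} (h : x ≤ y) (s : ℕ) : cMax U y s ≤ cMax U x s :=
  Finset.sup_mono (Finset.Ioc_subset_Ioc_left h)

/-- Since `K U (y + 1)` is at most `y` plus a constant, the threshold `2 ^ (-y)` of column `y` is
absorbed into `cMax U y s`. -/
theorem IsUniversal.exists_half_pow_le_cMax (hU : IsUniversal U) : ∃ c : ℕ, ∀ y, ∃ t, ∀ s ≥ t,
    (1 / 2 : ℝ) ^ y ≤ 2 ^ c * cMax U y s := by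
  obtain ⟨c, hc⟩ := hU.exists_K_le (r := some) (x := fun n => Part.some (n + 1))
    Computable.option_some Computable.succ.partrec
    (by simpa using summable_geometric_two)
  refine ⟨c, fun y => ?_⟩
  obtain ⟨t, ht⟩ := exists_KStage_le (U := U) (y + 1)
  refine ⟨t + y + 1, fun s hs => ?_⟩
  have h1 : KStage U s (y + 1) ≤ ((y + c : ℕ) : ℕ∞) := by
    have := (ht s (by omega)).trans (hc y y (y + 1) rfl (Part.mem_some _))
    exact_mod_cast this
  have h2 : twoPowNeg ((y + c : ℕ) : ℕ∞) ≤ cMax U y s :=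
    (twoPowNeg_anti h1).trans (Finset.le_sup (f := fun w => twoPowNeg (KStage U s w))
      (Finset.mem_Ioc.2 ⟨Nat.lt_succ_self y, by omega⟩))
  have h3 : ((1 / 2 : ℝ)) ^ (y + c) ≤ cMax U y s := by
    rw [← cast_twoPowNeg_coe]
    exact_mod_cast h2
  calc (1 / 2 : ℝ) ^ y = 2 ^ c * (1 / 2) ^ (y + c) := by
        rw [pow_add, mul_left_comm, ← mul_pow]; norm_num
    _ ≤ _ := by gcongr

/-- The unused position of column `y` lies between `y` and `columnBound y`. It eventually fails to
qualify, which bounds the weight of the segments beyond it; `K`-triviality replaces segments by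
their lengths. -/
theorem IsUniversal.exists_sum_le_cMax (hU : IsUniversal U) (h : IsKTrivial U (limitSet U)) :
    ∃ D : ℕ, ∀ (y : ℕ) (F : Finset ℕ), (∀ n ∈ F, columnBound y < n) →
      ∃ t, ∀ s ≥ t, ∑ n ∈ F, (twoPowNeg (K U n) : ℝ) ≤ 2 ^ D * cMax U y s := by
  obtain ⟨b, hb⟩ := h
  obtain ⟨c, hc⟩ := hU.exists_half_pow_le_cMax
  refine ⟨b + c, fun y F hF => ?_⟩
  obtain ⟨i, hi, hnever⟩ := exists_never_actPos hU.1 y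
  have hx : Nat.pair y i ≤ columnBound y := by
    rcases hi.eq_or_lt with rfl | h
    · exact le_rfl
    · exact (Nat.pair_lt_pair_right _ h).le
  obtain ⟨t₁, ht₁⟩ := exists_sum_initSeg_lt hnever (F := F) fun n hn => hx.trans_lt (hF n hn)
  obtain ⟨t₂, ht₂⟩ := hc y
  refine ⟨max t₁ t₂, fun s hs => ?_⟩
  have h1 := ht₁ s ((le_max_left _ _).trans hs)
  have h2 := ht₂ s ((le_max_right _ _).trans hs)
  have h3 : max (cMax U (Nat.pair y i) s : ℝ) ((1 / 2) ^ (Nat.pair y i).unpair.1) ≤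
      2 ^ c * cMax U y s := by
    rw [Nat.unpair_pair]
    refine max_le ?_ h2
    have h4 : (cMax U (Nat.pair y i) s : ℝ) ≤ cMax U y s := by
      exact_mod_cast cMax_anti (Nat.left_le_pair y i) s
    refine h4.trans (le_mul_of_one_le_left (NNRat.cast_nonneg _) (one_le_pow₀ one_le_two))
  have h5 : ∑ n ∈ F, (twoPowNeg (K U n) : ℝ) ≤
      ∑ n ∈ F, 2 ^ b * (twoPowNeg (KStr U (initSeg (limitSet U) n)) : ℝ) := by
    refine Finset.sum_le_sum fun n _ => ?_
    have h6 := cast_twoPowNeg_anti (hb n)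
    rw [cast_twoPowNeg_add] at h6
    calc (twoPowNeg (K U n) : ℝ) = 2 ^ b * (twoPowNeg (K U n) * (1 / 2) ^ b) := by
          rw [mul_left_comm, ← mul_pow]; norm_num
      _ ≤ _ := by gcongr
  rw [← Finset.mul_sum] at h5
  calc ∑ n ∈ F, (twoPowNeg (K U n) : ℝ) ≤ _ := h5
    _ ≤ 2 ^ b * (2 ^ c * cMax U y s) := by gcongr; exact h1.le.trans h3
    _ = _ := by rw [pow_add, mul_assoc]

theorem exists_isRunStage {d D e : ℕ}
    (hd : ∀ i s, i ≤ 2 ^ runExp e → IsRunStage U e i s →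
      K U (columnBound s + 1) ≤ (runExp e + e + d : ℕ))
    (hD : ∀ (y : ℕ) (F : Finset ℕ), (∀ n ∈ F, columnBound y < n) →
      ∃ t, ∀ s ≥ t, ∑ n ∈ F, (twoPowNeg (K U n) : ℝ) ≤ 2 ^ D * cMax U y s)
    (he : d + D ≤ e) (i : ℕ) (hi : i ≤ 2 ^ runExp e) : ∃ s, IsRunStage U e i s := by
  classical
  induction i with
  | zero => exact ⟨0, rfl, fun q hq => by simp [runList] at hq⟩
  | succ i ih =>
    obtain ⟨s, hs⟩ := ih (by omega)
    set l := runList U e (s + 1) with hl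
    have hlen : l.length = i + 1 := by
      rw [hl, runList_succ, if_pos hs.2, List.length_cons, hs.1]
    have hK : ∀ r < i + 1, K U (columnBound (l.getD r 0) + 1) ≤ (runExp e + e + d : ℕ) := by
      intro r hr
      obtain ⟨-, h2, h3⟩ := runList_getD (U := U) (e := e) (s := s + 1) (r := r)
        (by rw [← hl]; omega)
      refine hd (i - r) _ (by omega) ⟨?_, h3⟩
      rw [h2, List.length_drop, ← hl]
      omega
    have hready : ∃ t, ∀ s' ≥ t, RunReady U e l s' := by
      -- The `q + 1` latest stages have placed their weights at points beyond `columnBound (l.getD q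
      -- 0)`, so `hD` eventually forces a comparably heavy single number above `l.getD q 0`.
      have key : ∀ q, ∃ t, ∀ s' ≥ t, q < i + 1 →
          ((q + 1 : ℕ) : ℝ) * (1 / 2) ^ (runExp e + 2 * e) ≤ cMax U (l.getD q 0) s' := by
        intro q
        by_cases hq : q < i + 1
        swap
        · exact ⟨0, fun _ _ h => absurd h hq⟩
        have hmono : ∀ r ∈ Finset.range (q + 1), l.getD q 0 ≤ l.getD r 0 := by
          intro r hr
          rcases (Nat.lt_succ_iff.1 (Finset.mem_range.1 hr)).eq_or_lt with rfl | h
          · exact le_rfl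
          · exact (runList_getD_lt h (by rw [← hl]; omega)).le
        have hinj : Set.InjOn (fun r => columnBound (l.getD r 0) + 1) (Finset.range (q + 1)) := by
          have : ∀ a b, a < b → b < q + 1 →
              columnBound (l.getD b 0) + 1 < columnBound (l.getD a 0) + 1 := fun a b hab hb =>
            Nat.succ_lt_succ (columnBound_lt (runList_getD_lt hab (by rw [← hl]; omega)))
          intro a ha b hb e
          simp only [Finset.coe_range, Set.mem_Iio] at ha hb
          rcases lt_trichotomy a b with h | h | h
          · have := this a b h hb
            simp only at e
            omega
          · exact h
          · have := this b a h ha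
            simp only at e
            omega
        obtain ⟨t, ht⟩ := hD (l.getD q 0)
          ((Finset.range (q + 1)).image fun r => columnBound (l.getD r 0) + 1) (by
            intro n hn
            obtain ⟨r, hr, rfl⟩ := Finset.mem_image.1 hn
            rcases (hmono r hr).eq_or_lt with h | h
            · rw [h]; exact Nat.lt_succ_self _
            · exact (columnBound_lt h).trans (Nat.lt_succ_self _))
        refine ⟨t, fun s' hs' _ => ?_⟩
        have h1 := ht s' hs'
        rw [Finset.sum_image hinj] at h1
        have h2 : ((q + 1 : ℕ) : ℝ) * (1 / 2) ^ (runExp e + e + d) ≤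
            ∑ r ∈ Finset.range (q + 1), (twoPowNeg (K U (columnBound (l.getD r 0) + 1)) : ℝ) := by
          rw [← nsmul_eq_mul, ← Finset.card_range (q + 1), ← Finset.sum_const, Finset.card_range]
          refine Finset.sum_le_sum fun r hr => ?_
          rw [← cast_twoPowNeg_coe]
          exact cast_twoPowNeg_anti (hK r (by have := Finset.mem_range.1 hr; omega))
        -- The second `e` in the exponent of the test pays for the constants `d` and `D`.
        have h3 : (1 / 2 : ℝ) ^ (runExp e + 2 * e) ≤ (1 / 2) ^ (runExp e + e + d) * (1 / 2) ^ D := by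
          rw [← pow_add]
          exact pow_le_pow_of_le_one (by norm_num) (by norm_num) (by omega)
        calc ((q + 1 : ℕ) : ℝ) * (1 / 2) ^ (runExp e + 2 * e)
            ≤ (q + 1 : ℕ) * ((1 / 2) ^ (runExp e + e + d) * (1 / 2) ^ D) := by gcongr
          _ = ((q + 1 : ℕ) * (1 / 2) ^ (runExp e + e + d)) * (1 / 2) ^ D := by ring
          _ ≤ (2 ^ D * cMax U (l.getD q 0) s') * (1 / 2) ^ D := by
              exact mul_le_mul_of_nonneg_right (h2.trans h1) (by positivity)
          _ = cMax U (l.getD q 0) s' := by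
              rw [mul_right_comm, ← mul_pow]; norm_num
      choose t ht using key
      refine ⟨(Finset.range (i + 1)).sup t, fun s' hs' q hq => ?_⟩
      rw [List.mem_range, hlen] at hq
      have h1 := ht q s' ((Finset.le_sup (Finset.mem_range.2 hq)).trans hs') hq
      rw [cMax_eq, capped] at h1
      split_ifs at h1 with hlt
      · refine ⟨hlt, ?_⟩
        rw [cast_twoPowNeg_coe, one_div, inv_pow, inv_pow, ← div_eq_mul_inv, div_le_iff₀ (by positivity),
          inv_mul_eq_div, le_div_iff₀ (by positivity)] at h1
        exact_mod_cast h1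
      · have : (0 : ℝ) < ((q + 1 : ℕ) : ℝ) * (1 / 2) ^ (runExp e + 2 * e) := by positivity
        simp only [twoPowNeg_top, NNRat.cast_zero] at h1
        linarith
    -- Without a next stage the list stays equal to `l` forever, but `l` eventually passes the test.
    by_contra hno
    push Not at hno
    have hconst : ∀ s' ≥ s + 1, runList U e s' = l := by
      intro s' hs'
      induction s', hs' using Nat.le_induction with
      | base => rfl
      | succ s' _ ih =>
        rw [runList_succ, if_neg, ih]
        intro hr
        exact hno s' ⟨by rw [ih, hlen], hr⟩
    obtain ⟨t, ht⟩ := hready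
    refine hno (max t (s + 1)) ⟨?_, ?_⟩
    · rw [hconst _ (le_max_right _ _), hlen]
    · rw [hconst _ (le_max_right _ _)]
      exact ht _ (le_max_left _ _)

theorem not_isRunStage_last (hU : IsPrefixFree U) (e s : ℕ) :
    ¬ IsRunStage U e (2 ^ runExp e) s := by
  intro hs
  set l := runList U e (s + 1) with hl
  set N := 2 ^ runExp e with hN
  have hlen : l.length = N + 1 := by
    rw [hl, runList_succ, if_pos hs.2, List.length_cons, hs.1]
  -- The list is decreasing, so the `j`-th stage is entry `N - j`. Seen from the `i`-th stage it is
  -- entry `i - j - 1` of the history, and the test at that stage gives the factor `i - j`.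
  have hheavy : ∀ j i, j < i → i ≤ N → ∃ w ∈ Finset.Ioc (l.getD (N - j) 0) (l.getD (N - i) 0),
      ((i - j : ℕ) : ℝ) * (1 / 2) ^ (runExp e + 2 * e) ≤ twoPowNeg (K U w) := by
    intro j i hji hi
    obtain ⟨-, h2, h3⟩ := runList_getD (U := U) (e := e) (s := s + 1) (r := N - i)
      (by rw [← hl]; omega)
    rw [h2, ← hl] at h3
    have h4 := h3 (i - j - 1) (by rw [List.mem_range, List.length_drop, hlen]; omega)
    rw [List.getD_eq_getElem?_getD, List.getElem?_drop,
      show N - i + 1 + (i - j - 1) = N - j by omega, ← List.getD_eq_getElem?_getD,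
      show i - j - 1 + 1 = i - j by omega] at h4
    obtain ⟨hlt, h5⟩ := h4
    rcases stageLengthAbove_le_iff.1 (le_refl (stageLengthAbove U (l.getD (N - j) 0)
      (l.getD (N - i) 0))) with h6 | ⟨w, hw, h6⟩
    · omega
    refine ⟨w, hw, ?_⟩
    have h7 : K U w ≤ (stageLengthAbove U (l.getD (N - j) 0) (l.getD (N - i) 0) : ℕ) := by
      refine (K_le_KStage _ _).trans (?_ : KStage U (l.getD (N - i) 0) w ≤ _)
      rw [KStage_eq_capped, capped_le_iff]
      exact ⟨h6.trans_lt hlt, h6⟩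
    refine le_trans ?_ (cast_twoPowNeg_anti h7)
    rw [cast_twoPowNeg_coe, one_div, inv_pow, inv_pow, ← div_eq_mul_inv, div_le_iff₀ (by positivity),
      inv_mul_eq_div, le_div_iff₀ (by positivity)]
    exact_mod_cast h5
  have h1 := sum_min_ge_of_heavy (fun w => NNRat.cast_nonneg _) (t := fun j => l.getD (N - j) 0) hheavy (by positivity)
    (runExp e) 0 (by rw [zero_add])
  have h2 : ∑ w ∈ Finset.Ioc (l.getD (N - 0) 0) (l.getD (N - (0 + 2 ^ runExp e)) 0),
      min (twoPowNeg (K U w) : ℝ) (2 ^ runExp e * (1 / 2) ^ (runExp e + 2 * e)) ≤ 1 :=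
    (Finset.sum_le_sum fun w _ => min_le_left _ _).trans (sum_twoPowNeg_K_le_one hU _)
  have h3 := h1.trans h2
  -- The choice `runExp e = 4 * 2 ^ (2 * e)` makes the gain `runExp e / 2` beat the loss `2 ^ (-2 *
  -- e)`, leaving more than the permitted total of one.
  have h4 : (1 + (runExp e : ℝ) / 2) * 2 ^ runExp e * (1 / 2) ^ (runExp e + 2 * e) =
      (1 / 2) ^ (2 * e) + 2 := by
    have e1 : (2 : ℝ) ^ runExp e * (1 / 2) ^ runExp e = 1 := by rw [← mul_pow]; norm_num
    have e2 : (2 : ℝ) ^ (2 * e) * (1 / 2) ^ (2 * e) = 1 := by rw [← mul_pow]; norm_num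
    have e3 : (runExp e : ℝ) = 2 ^ (2 * e) * 4 := by
      rw [runExp]; push_cast; rw [pow_add]; norm_num
    rw [pow_add, mul_assoc, ← mul_assoc (2 ^ runExp e), e1, one_mul, e3]
    linear_combination 2 * e2
  rw [h4] at h3
  have : (0 : ℝ) < (1 / 2) ^ (2 * e) := by positivity
  linarith

theorem not_isKTrivial_limitSet (hU : IsUniversal U) : ¬ IsKTrivial U (limitSet U) := by
  intro h
  obtain ⟨d, hd⟩ := hU.exists_K_runStage_le
  obtain ⟨D, hD⟩ := hU.exists_sum_le_cMax h
  obtain ⟨s, hs⟩ := exists_isRunStage (hd (d + D)) hD le_rfl _ le_rfl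
  exact not_isRunStage_last hU.1 _ s hs

end CostCalculus

theorem mainTheorem7 (U : Nat.Partrec.Code) (hU : CostCalculus.IsUniversal U) :
    ∃ A : Set ℕ,
      (∃ As : ℕ → Finset ℕ,
        CostCalculus.IsComputableApprox As A ∧
        CostCalculus.IsErasing As ∧
        CostCalculus.SeqObeys As (CostCalculus.cMax U)) ∧
      ¬ CostCalculus.SetObeys A (CostCalculus.cK U) ∧
      CostCalculus.IsWeaklyKTrivial U A ∧
      ¬ CostCalculus.IsKTrivial U A :=
  ⟨CostCalculus.limitSet U,
    ⟨_, CostCalculus.isComputableApprox_limitSet, CostCalculus.isErasing_stageList,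
      CostCalculus.seqObeys_stageList hU.1⟩,
    fun h => CostCalculus.not_isKTrivial_limitSet hU (hU.isKTrivial_of_obeys h),
    CostCalculus.isWeaklyKTrivial_limitSet hU, CostCalculus.not_isKTrivial_limitSet hU⟩
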